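/- Let $G$ be an undirected graph on a finite vertex set $V=\{X_1,\dots,X_n\}$, where each vertex $X_v$ is a discrete variable with a finite set $I_v$ of at least two levels, and let $\mathcal X=\prod_{v} I_v$. Let $A(G)$ be the $0/1$ matrix whose columns are indexed by $\mathcal X$ and whose rows are indexed by the pairs $(C,c)$ with $C$ a maximal clique of $G$ and $c\in\prod_{v\in C}I_v$; the entry at $((C,c),x)$ is $1$ if and only if $x|_C=c$. Let $a_x$ be the column of $A(G)$ indexed by $x$ and let $\phi_{A(G)}$ be the map on nonnegative real vectors $t\mapsto\big(\prod_i t_i^{a_{ix}}\big)_{x\in\mathcal X}$ (with $0^0=1$). A probability distribution $P=(p_x)_{x\in\mathcal X}$ *factors according to* $G$ if $P\in\operatorname{image}(\phi_{A(G)})$. The toric ideal $I_{A(G)}\subset\mathbf R[p_x : x\in\mathcal X]$ is generated by all binomials $p^u-p^w$ with $u,w\in\mathbf N^{\mathcal X}$ and $A(G)u=A(G)w$. A *global separation statement* of $G$ is a triple of pairwise disjoint sets $X,Y,Z\subseteq V$ with $X\cup Y\cup Z=V$ such that every path in $G$ from a vertex of $X$ to a vertex of $Y$ passes through $Z$. The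 quadratic binomials *corresponding* to it are $p_{x,y,z}\,p_{x',y',z}-p_{x',y,z}\,p_{x,y',z}$, where $x\ne x'$ are levels of $X$, $y\neq y'$ are levels of $Y$, and $z$ is a level of $Z$. For a nonzero table of counts $u\in\mathbf N^{\mathcal X}$, a *maximum likelihood estimate* is a maximizer of $\prod_{x}p_x^{u_x}$ over the extended model, that is, the set of distributions that factor according to $G$ or are limits of distributions that factor according to $G$. Fix a subfield $K$ of $\mathbf R$ (for example $\mathbf Q$ or $\mathbf R$). **Theorem 4.4.** The following five statements are equivalent: (a) $G$ is decomposable, i.e. chordal: every cycle of length at least $4$ has a chord. (b) There is a set $B$ of quadratic binomials, each corresponding to a global separation statement of $G$, such that a probability distribution $P$ factors according to $G$ if and only if every element of $B$ vanishes at $P$. (c) For some monomial order, the ideal $I_{A(G)}$ has a Gröbner basis in which each polynomial is a quadratic binomial corresponding to a global separation statement of $G$. (d) The maximum likelihood estimate for $G$ is a rational function of the counts with coefficients in $K$: there are polynomials $f_x,g_x$ over $K$ in the counts, $g_x\neq0$ $(x\in\mathcal X)$, such that for every nonzero table of counts $u\in\mathbf N^{\mathcal X}$ with $g_x(u)\ne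 0$ for all $x$, the vector $(f_x(u)/g_x(u))_{x\in\mathcal X}$ is the unique maximum likelihood estimate for $u$. (e) The set $\operatorname{image}(\phi_{A(G)})$ is closed. -/

import Mathlib

universe u w

noncomputable section

namespace DiscreteModel

open MvPolynomial

/-! ### Exponential models given by a nonnegative integer matrix -/

/-- The monomial map `t ↦ (∏ i, t i ^ A i j)_j`; here `0 ^ 0 = 1`. -/
def phi {R C : Type*} [Fintype R] (A : Matrix R C ℕ) (t : R → ℝ) : C → ℝ :=
  fun j => ∏ i, t i ^ A i j

/-- The image under `phi A` of the nonnegative orthant. -/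
def imagePhi {R C : Type*} [Fintype R] (A : Matrix R C ℕ) : Set (C → ℝ) :=
  phi A '' {t | ∀ i, 0 ≤ t i}

/-- The probability distributions that factor according to `A`. -/
def factoring {R C : Type*} [Fintype R] [Fintype C] (A : Matrix R C ℕ) : Set (C → ℝ) :=
  imagePhi A ∩ stdSimplex ℝ C

/-- The extended model: the distributions that factor according to `A` and their limits. -/
def extendedModel {R C : Type*} [Fintype R] [Fintype C] (A : Matrix R C ℕ) : Set (C → ℝ) :=
  closure (factoring A)

/-- The toric ideal of `A`, generated by the binomials `p^u - p^v` with `A u = A v`. -/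
def toricIdeal {R C : Type*} [Fintype C] (A : Matrix R C ℕ) : Ideal (MvPolynomial C ℝ) :=
  Ideal.span {f | ∃ u v : C →₀ ℕ, A.mulVec u = A.mulVec v ∧
    f = monomial u (1 : ℝ) - monomial v (1 : ℝ)}

/-- `B` is a Gröbner basis of the ideal `J` for the monomial order `m`: it generates `J`, and the
leading terms of its elements generate the ideal of all leading terms of elements of `J`. -/
def IsGroebnerBasis {σ : Type*} (m : MonomialOrder σ) (B : Set (MvPolynomial σ ℝ))
    (J : Ideal (MvPolynomial σ ℝ)) : Prop :=
  Ideal.span B = J ∧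
    Ideal.span (m.leadingTerm '' B) = Ideal.span (m.leadingTerm '' (J : Set (MvPolynomial σ ℝ)))

/-- The likelihood of `p` for a table of counts `u`. -/
def likelihood {C : Type*} [Fintype C] (u : C → ℕ) (p : C → ℝ) : ℝ :=
  ∏ x, p x ^ u x

/-- `p` is a maximum likelihood estimate, in the extended model, for the table of counts `u`. -/
def IsMLE {R C : Type*} [Fintype R] [Fintype C] (A : Matrix R C ℕ) (u : C → ℕ) (p : C → ℝ) :
    Prop :=
  p ∈ extendedModel A ∧ ∀ q ∈ extendedModel A, likelihood u q ≤ likelihood u p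

/-- The maximum likelihood estimate is a rational function of the counts with coefficients in `K`:
there are fractions of polynomials `f x / g x` (one for each cell `x`, with `g x` not the zero
polynomial) such that, for every nonzero table of counts at which no denominator vanishes, the
vector of their values is the one and only maximum likelihood estimate. -/
def MLEIsRational {R C : Type*} [Fintype R] [Fintype C] (A : Matrix R C ℕ) (K : Subfield ℝ) :
    Prop :=
  ∃ f g : C → MvPolynomial C K, (∀ x, g x ≠ 0) ∧
    ∀ u : C → ℕ, u ≠ 0 → (∀ x, aeval (fun y => (u y : ℝ)) (g x) ≠ 0) →
      ∀ p : C → ℝ, IsMLE A u p ↔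
        ∀ x, p x = aeval (fun y => (u y : ℝ)) (f x) / aeval (fun y => (u y : ℝ)) (g x)

/-! ### Undirected graphical models -/

/-- `G` is decomposable (chordal): every cycle of length at least four has a chord, that is, an
edge of `G` that joins two vertices of the cycle and is not an edge of the cycle. -/
def IsDecomposable {V : Type*} (G : SimpleGraph V) : Prop :=
  ∀ (v : V) (c : G.Walk v v), c.IsCycle → 4 ≤ c.length →
    ∃ a ∈ c.support, ∃ b ∈ c.support, G.Adj a b ∧ s(a, b) ∉ c.edges

/-- The cells of the contingency table: a level for each variable. -/
abbrev State {V : Type*} (I : V → Type*) := ∀ v, I v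

/-- The maximal complete sets of vertices. -/
abbrev MaxClique {V : Type*} (G : SimpleGraph V) :=
  {C : Finset V // Maximal (fun s : Finset V => G.IsClique (s : Set V)) C}

/-- The row indices of `A(G)`: a maximal clique together with a level for each of its variables. -/
abbrev CliqueRow {V : Type*} (G : SimpleGraph V) (I : V → Type*) :=
  Σ C : MaxClique G, ∀ v : {v // v ∈ C.1}, I v

instance {V : Type*} [Fintype V] (G : SimpleGraph V) : Fintype (MaxClique G) := by
  classical infer_instance

/-- The matrix `A(G)`: the entry is `1` if the row index is the projection of the column index to
the clique of the row, and `0` otherwise. -/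
def cliqueMatrix {V : Type*} (G : SimpleGraph V) (I : V → Type*) [∀ v, DecidableEq (I v)] :
    Matrix (CliqueRow G I) (State I) ℕ :=
  fun r x => if ∀ v : {v // v ∈ r.1.1}, x v = r.2 v then 1 else 0

/-- `S` separates `A` from `B` in `G`: every path from a vertex of `A` to a vertex of `B` passes
through a vertex of `S`. -/
def Separates {V : Type*} (G : SimpleGraph V) (A B S : Finset V) : Prop :=
  ∀ a ∈ A, ∀ b ∈ B, ∀ p : G.Walk a b, p.IsPath → ∃ v ∈ S, v ∈ p.support

/-- The saturated separation statements of `G`: three pairwise disjoint sets of variables, the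
third separating the first from the second, that together contain all variables. -/
def SaturatedSeparation {V : Type*} [Fintype V] [DecidableEq V] (G : SimpleGraph V)
    (A B S : Finset V) : Prop :=
  Disjoint A B ∧ Disjoint A S ∧ Disjoint B S ∧ A ∪ B ∪ S = Finset.univ ∧ Separates G A B S

/-- The cell with the levels of `x` on `A`, of `y` on `B`, and of `z` on the other variables. -/
def cell {V : Type*} [DecidableEq V] {I : V → Type*} (A B : Finset V) (x y z : State I) :
    State I :=
  A.piecewise x (B.piecewise y z)

/-- The cross-product difference `P(x,y,z) P(x',y',z) - P(x',y,z) P(x,y',z)`, as a polynomial.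
Only the levels of `x`, `x'` on `A`, of `y`, `y'` on `B` and of `z` outside `A ∪ B` matter. -/
def cpd {V : Type*} [DecidableEq V] {I : V → Type*} (A B : Finset V) (x x' y y' z : State I) :
    MvPolynomial (State I) ℝ :=
  X (cell A B x y z) * X (cell A B x' y' z) - X (cell A B x' y z) * X (cell A B x y' z)

/-- The quadratic binomials that correspond to the global separation statements of `G`: all
cross-product differences, for distinct levels of `A` and distinct levels of `B`, of all saturated
separation statements. -/
def globalBinomials {V : Type*} [Fintype V] [DecidableEq V] (G : SimpleGraph V) (I : V → Type*) :
    Set (MvPolynomial (State I) ℝ) :=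
  {f | ∃ A B S : Finset V, SaturatedSeparation G A B S ∧
    ∃ x x' y y' z : State I, (∃ v ∈ A, x v ≠ x' v) ∧ (∃ v ∈ B, y v ≠ y' v) ∧
      f = cpd A B x x' y y' z}

end DiscreteModel

end

/-!
Let `G` be chordal. By Dirac's theorem it has a simplicial vertex, hence an ordering of the vertices
in which the earlier neighbours of each vertex form a clique
(`IsDecomposable.exists_perfectElimination`). A vertex is separated from the earlier vertices by its
earlier neighbours, and each such separation extends to a saturated one (`exists_separation`). A
nonnegative table at which the binomials of all saturated separations vanish (`GlobalMarkov`) is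
therefore the telescoping product of the conditional distributions of each vertex given its earlier
neighbours (`eq_prod_marg`). This has four consequences.

* Each conditional distribution is a function of a clique, so such a table lies in the image of the
  monomial map (`GlobalMarkov.mem_imagePhi`), while the binomials vanish on the image anyway. Hence
  the binomials cut out the model.
* The image is a cone and the zero set of the binomials is closed, so any such description makes the
  image closed (`isClosed_imagePhi_of_binomials`).
* A maximum likelihood estimate has the clique marginals of the counts, and these determine it
  (`IsMLE.marginals_eq`, `eq_of_marginals_eq`). Substitution into the product formula writes it as a
  rational function of the counts (`mleIsRational_of_perfectElimination`).
* Order the cells lexicographically along the ordering. Of two distinct monomials with the same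
  clique marginals, one is divisible by a pair of cells that are ordered in the same way before some
  vertex and at it (`exists_sortedPair`). Such a pair is the leading term of a separation binomial,
  so division by these binomials identifies all monomials with the same marginals, and they form a
  Gröbner basis (`isGroebnerBasis_of_reducible`, `exists_groebnerBasis_of_perfectElimination`).

Let `G` be not chordal. It has a chordless cycle of length at least four, whose vertices fall into
four consecutive blocks (`IsFourCycleMinor`). Tables supported on the cells that are constant on
each block, with two levels, and of fixed level off the cycle, behave like tables of the binary
four-cycle.

* Give weight `ε` to disagreement along three of the edges and to agreement along the fourth. As `ε`
  tends to `0`, the tables rescaled by `ε⁻¹` have a limit outside the image, so the image is not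
  closed (`IsFourCycleMinor.not_isClosed_imagePhi`).
* All separation binomials vanish at the indicator of a parity class of configurations, but a
  quartic binomial of the toric ideal does not (`IsFourCycleMinor.span_ne_toricIdeal`).
* For the counts `1` on the two constant configurations and `n` on the two alternating ones, the
  estimate is proportional to `q ^ d`, where `d` is the number of disagreeing edges and
  `s = q ^ 2` satisfies `s ^ 2 = 3 (n - 1) s + n`. The discriminant `9 n ^ 2 - 14 n + 9` is not a
  square in `ℝ(n)`, so the estimate is not rational. Since the denominators may vanish at these
  counts, they are approached along `k c + w` with `w` generic and `k` tending to infinity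
  (`IsFourCycleMinor.not_mleIsRational`).
-/

noncomputable section

set_option linter.unusedSectionVars false

namespace DiscreteModel

/-! ### The monomial map and potentials on cliques -/

section

open MvPolynomial Filter Topology

section Monomial

variable {R C : Type*} [Fintype R] {A : Matrix R C ℕ}

theorem nonneg_of_mem_imagePhi {p : C → ℝ} (hp : p ∈ imagePhi A) (x : C) : 0 ≤ p x := by
  obtain ⟨t, ht, rfl⟩ := hp
  exact Finset.prod_nonneg fun i _ => pow_nonneg (ht i) _

theorem mul_mem_imagePhi {p q : C → ℝ} (hp : p ∈ imagePhi A) (hq : q ∈ imagePhi A) :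
    (fun x => p x * q x) ∈ imagePhi A := by
  obtain ⟨t, ht, rfl⟩ := hp
  obtain ⟨s, hs, rfl⟩ := hq
  refine ⟨fun i => t i * s i, fun i => mul_nonneg (ht i) (hs i), ?_⟩
  funext x
  simp [phi, mul_pow, Finset.prod_mul_distrib]

theorem one_mem_imagePhi : (fun _ => 1) ∈ imagePhi A :=
  ⟨fun _ => 1, fun _ => zero_le_one, by funext x; simp [phi]⟩

theorem prod_mem_imagePhi {ι : Type*} (s : Finset ι) (ψ : ι → C → ℝ)
    (h : ∀ i ∈ s, ψ i ∈ imagePhi A) : (fun x => ∏ i ∈ s, ψ i x) ∈ imagePhi A := by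
  classical
  induction s using Finset.induction_on with
  | empty => simpa using one_mem_imagePhi
  | insert a s ha ih =>
    simp only [Finset.prod_insert ha]
    exact mul_mem_imagePhi (h a (by simp)) (ih fun i hi => h i (by simp [hi]))

end Monomial

section Clique

variable {V : Type u} [Fintype V] [DecidableEq V] {G : SimpleGraph V}
  {I : V → Type w} [∀ v, Fintype (I v)] [∀ v, DecidableEq (I v)]

/-- The monomial map of `A(G)` is a product over the maximal cliques, since each cell lies in
exactly one row of each clique. -/
theorem phi_cliqueMatrix (t : CliqueRow G I → ℝ) (x : State I) :
    phi (cliqueMatrix G I) t x = ∏ C : MaxClique G, t ⟨C, fun v => x v⟩ := by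
  unfold phi
  rw [Fintype.prod_sigma]
  refine Finset.prod_congr rfl fun C _ => ?_
  refine (Fintype.prod_eq_single (f := fun c => t ⟨C, c⟩ ^ cliqueMatrix G I ⟨C, c⟩ x)
    (fun v => x v) fun c hc => ?_).trans ?_
  · have : ¬ ∀ v : {v // v ∈ C.1}, x v = c v := fun h => hc (funext fun v => (h v).symm)
    simp only [cliqueMatrix, this, if_false, pow_zero]
  · simp [cliqueMatrix]

theorem exists_maxClique_superset {s : Finset V} (hs : G.IsClique (s : Set V)) :
    ∃ C : MaxClique G, s ⊆ C.1 := by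
  obtain ⟨C, hC, hC'⟩ := Finite.exists_le_maximal (p := fun s : Finset V => G.IsClique (s : Set V)) hs
  exact ⟨⟨C, hC'⟩, hC⟩

/-- A function of the cells that depends only on the variables of the set `s`. -/
def DependsOnlyOn {β : Type*} (s : Finset V) (ψ : State I → β) : Prop :=
  ∀ x y : State I, (∀ v ∈ s, x v = y v) → ψ x = ψ y

theorem mem_imagePhi_of_clique [∀ v, Nonempty (I v)] {s : Finset V}
    (hs : G.IsClique (s : Set V)) {ψ : State I → ℝ} (h0 : ∀ x, 0 ≤ ψ x)
    (hψ : DependsOnlyOn s ψ) : ψ ∈ imagePhi (cliqueMatrix G I) := by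
  classical
  obtain ⟨M, hM⟩ := exists_maxClique_superset hs
  let ext (c : ∀ v : {v // v ∈ M.1}, I v) : State I := fun v =>
    if h : v ∈ M.1 then c ⟨v, h⟩ else Classical.arbitrary (I v)
  refine ⟨fun r => if h : r.1 = M then ψ (ext (h ▸ r.2)) else 1, ?_, ?_⟩
  · intro r
    by_cases h : r.1 = M
    · simp only [h, dite_true]; exact h0 _
    · simp [h]
  · funext x
    rw [phi_cliqueMatrix, Fintype.prod_eq_single M]
    · simp only [dite_true]
      apply hψ
      intro v hv
      simp [ext, hM hv]
    · intro C hC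
      simp [hC]

theorem const_mem_imagePhi [∀ v, Nonempty (I v)] {c : ℝ} (hc : 0 ≤ c) :
    (fun _ => c) ∈ imagePhi (cliqueMatrix G I) :=
  mem_imagePhi_of_clique (s := ∅) (by simp) (fun _ => hc) fun _ _ _ => rfl

/-- A signed table with vanishing clique marginals is orthogonal to every function of the
variables of a clique. -/
theorem sum_mul_eq_zero_of_clique {d : State I → ℝ}
    (hd : ∀ r, ∑ x, (cliqueMatrix G I r x : ℝ) * d x = 0) {s : Finset V}
    (hs : G.IsClique (s : Set V)) {h : State I → ℝ} (hh : DependsOnlyOn s h) :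
    ∑ x, h x * d x = 0 := by
  classical
  obtain ⟨M, hM⟩ := exists_maxClique_superset hs
  let res : State I → (∀ v : {v // v ∈ M.1}, I v) := fun x v => x v
  rw [← Finset.sum_fiberwise (s := Finset.univ) (g := res)]
  refine Finset.sum_eq_zero fun c _ => ?_
  by_cases hne : ∃ z, res z = c
  · obtain ⟨z, rfl⟩ := hne
    have := hd ⟨M, res z⟩
    have h2 : ∑ x with res x = res z, h x * d x = h z * ∑ x with res x = res z, d x := by
      rw [Finset.mul_sum]
      refine Finset.sum_congr rfl fun x hx => ?_
      rw [hh x z]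
      intro v hv
      exact congrFun (Finset.mem_filter.1 hx).2 ⟨v, hM hv⟩
    rw [h2, Finset.sum_filter]
    have h3 : ∑ a, (if res a = res z then d a else 0) = 0 := by
      refine Eq.trans (Finset.sum_congr rfl fun x _ => ?_) this
      have : (∀ v : {v // v ∈ M.1}, x v = res z v) ↔ res x = res z := by
        simp only [funext_iff]; rfl
      simp only [cliqueMatrix, this]
      split_ifs
      · rw [Nat.cast_one, one_mul]
      · rw [Nat.cast_zero, zero_mul]
    rw [h3, mul_zero]
  · rw [Finset.sum_eq_zero]
    intro x hx
    exact absurd ⟨x, (Finset.mem_filter.1 hx).2⟩ hne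

/-! ### Separations and swaps -/

theorem SaturatedSeparation.not_adj {A B S : Finset V} (h : SaturatedSeparation G A B S) {a b : V}
    (ha : a ∈ A) (hb : b ∈ B) : ¬ G.Adj a b := by
  intro hab
  obtain ⟨hAB, hAS, hBS, -, hsep⟩ := h
  obtain ⟨v, hv, hv'⟩ := hsep a ha b hb (SimpleGraph.Walk.cons hab .nil)
    (by simpa using hab.ne)
  simp only [SimpleGraph.Walk.support_cons, SimpleGraph.Walk.support_nil, List.mem_cons,
    List.not_mem_nil, or_false] at hv'
  rcases hv' with rfl | rfl
  · exact Finset.disjoint_left.1 hAS ha hv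
  · exact Finset.disjoint_left.1 hBS hb hv

/-- For three disjoint sets that contain all vertices, separation means the absence of edges
between the two sides. -/
theorem saturatedSeparation_of_not_adj {A B S : Finset V} (hAB : Disjoint A B)
    (hAS : Disjoint A S) (hBS : Disjoint B S) (hU : A ∪ B ∪ S = Finset.univ)
    (hadj : ∀ a ∈ A, ∀ b ∈ B, ¬ G.Adj a b) : SaturatedSeparation G A B S := by
  refine ⟨hAB, hAS, hBS, hU, fun a ha b hb p hp => ?_⟩
  clear hp
  induction p with
  | nil => exact absurd hb (Finset.disjoint_left.1 hAB ha)
  | @cons a c b hac p ih =>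
    have hc : c ∈ A ∪ B ∪ S := by rw [hU]; exact Finset.mem_univ c
    simp only [Finset.mem_union] at hc
    rcases hc with (hc | hc) | hc
    · obtain ⟨v, hv, hv'⟩ := ih hc hb
      exact ⟨v, hv, by simp [hv']⟩
    · exact absurd hac (hadj a ha c hc)
    · exact ⟨c, hc, by simp⟩

theorem SaturatedSeparation.clique_disjoint {A B S : Finset V} (h : SaturatedSeparation G A B S)
    {C : Finset V} (hC : G.IsClique (C : Set V)) : (∀ v ∈ C, v ∉ A) ∨ ∀ v ∈ C, v ∉ B := by
  by_contra! hcon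
  obtain ⟨⟨a, haC, ha⟩, b, hbC, hb⟩ := hcon
  exact SaturatedSeparation.not_adj h ha hb (hC haC hbC fun hab =>
    Finset.disjoint_left.1 h.1 ha (hab ▸ hb))

theorem SaturatedSeparation.mem_of_notMem {A B S : Finset V} (h : SaturatedSeparation G A B S)
    {v : V} (hA : v ∉ A) (hB : v ∉ B) : v ∈ S := by
  have : v ∈ A ∪ B ∪ S := by rw [h.2.2.2.1]; exact Finset.mem_univ v
  simpa [hA, hB] using this

/-- A cross-product difference exchanges the levels on `A` between two cells that agree outside
`A ∪ B`. -/
theorem cpd_eq_swap (A B : Finset V) (x x' y y' z : State I) :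
    cpd A B x x' y y' z = X (cell A B x y z) * X (cell A B x' y' z) -
      X (A.piecewise (cell A B x' y' z) (cell A B x y z)) *
        X (A.piecewise (cell A B x y z) (cell A B x' y' z)) := by
  have h1 : cell A B x' y z = A.piecewise (cell A B x' y' z) (cell A B x y z) := by
    funext v; by_cases hv : v ∈ A <;> simp [cell, hv]
  have h2 : cell A B x y' z = A.piecewise (cell A B x y z) (cell A B x' y' z) := by
    funext v; by_cases hv : v ∈ A <;> simp [cell, hv]
  rw [cpd, h1, h2]

/-- Two cells that agree on `S`, and differ on `A` and on `B`, give a binomial of the separation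
`(A, B, S)`. -/
theorem swap_mem_globalBinomials {A B S : Finset V} (h : SaturatedSeparation G A B S)
    {r r' : State I} (hS : ∀ v ∈ S, r v = r' v) (hA : ∃ v ∈ A, r v ≠ r' v)
    (hB : ∃ v ∈ B, r v ≠ r' v) :
    (X r * X r' - X (A.piecewise r' r) * X (A.piecewise r r') : MvPolynomial (State I) ℝ) ∈
      globalBinomials G I := by
  have h1 : cell A B r r r = r := by
    funext v; simp [cell, Finset.piecewise]
  have h2 : cell A B r' r' r = r' := by
    funext v
    by_cases hA : v ∈ A
    · simp [cell, hA]
    by_cases hB : v ∈ B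
    · simp [cell, hA, hB]
    simp [cell, hA, hB, hS v (h.mem_of_notMem hA hB)]
  refine ⟨A, B, S, h, r, r', r, r', r, hA, hB, ?_⟩
  rw [cpd_eq_swap, h1, h2]

/-- A table satisfies the separation statements of `G` if exchanging the levels on `A` between two
cells that agree on `S` never changes the product of their entries. -/
def GlobalMarkov (G : SimpleGraph V) (P : State I → ℝ) : Prop :=
  ∀ A B S : Finset V, SaturatedSeparation G A B S → ∀ r r' : State I, (∀ v ∈ S, r v = r' v) →
    P r * P r' = P (A.piecewise r' r) * P (A.piecewise r r')

theorem globalMarkov_iff (P : State I → ℝ) :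
    GlobalMarkov G P ↔ ∀ f ∈ globalBinomials G I, eval P f = 0 := by
  constructor
  · rintro h f ⟨A, B, S, hs, x, x', y, y', z, -, -, rfl⟩
    rw [cpd_eq_swap]
    simp only [map_sub, map_mul, eval_X]
    rw [sub_eq_zero]
    refine h A B S hs _ _ fun v hv => ?_
    have h1 : v ∉ A := fun hA => Finset.disjoint_left.1 hs.2.1 hA hv
    have h2 : v ∉ B := fun hB => Finset.disjoint_left.1 hs.2.2.1 hB hv
    simp [cell, h1, h2]
  · intro h A B S hs r r' hS
    by_cases hA : ∃ v ∈ A, r v ≠ r' v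
    · by_cases hB : ∃ v ∈ B, r v ≠ r' v
      · have := h _ (swap_mem_globalBinomials hs hS hA hB)
        simpa [sub_eq_zero] using this
      · push Not at hB
        have h1 : A.piecewise r' r = r' := by
          funext v
          by_cases hv : v ∈ A
          · simp [hv]
          by_cases hv' : v ∈ B
          · simp [hv, hB v hv']
          · simp [hv, hS v (hs.mem_of_notMem hv hv')]
        have h2 : A.piecewise r r' = r := by
          funext v
          by_cases hv : v ∈ A
          · simp [hv]
          by_cases hv' : v ∈ B
          · simp [hv, hB v hv']
          · simp [hv, hS v (hs.mem_of_notMem hv hv')]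
        rw [h1, h2, mul_comm]
    · push Not at hA
      have h1 : A.piecewise r' r = r := by
        funext v; by_cases hv : v ∈ A <;> simp [hv, hA]
      have h2 : A.piecewise r r' = r' := by
        funext v; by_cases hv : v ∈ A <;> simp [hv, hA]
      rw [h1, h2]

/-- Exchanging the levels on `A` preserves, for each clique, the pair of restrictions to the
clique. -/
theorem SaturatedSeparation.clique_swap {A B S : Finset V} (h : SaturatedSeparation G A B S)
    {r r' : State I} (hS : ∀ v ∈ S, r v = r' v) {C : Finset V} (hC : G.IsClique (C : Set V)) :
    ((∀ v ∈ C, A.piecewise r' r v = r v) ∧ ∀ v ∈ C, A.piecewise r r' v = r' v) ∨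
    ((∀ v ∈ C, A.piecewise r' r v = r' v) ∧ ∀ v ∈ C, A.piecewise r r' v = r v) := by
  rcases h.clique_disjoint hC with hA | hB
  · left
    exact ⟨fun v hv => by simp [hA v hv], fun v hv => by simp [hA v hv]⟩
  · right
    have key : ∀ v ∈ C, v ∉ A → r v = r' v := fun v hv hA => hS v (h.mem_of_notMem hA (hB v hv))
    refine ⟨fun v hv => ?_, fun v hv => ?_⟩ <;> by_cases hA : v ∈ A
    · simp [hA]
    · simp [hA, key v hv hA]
    · simp [hA]
    · simp [hA, key v hv hA]

theorem globalMarkov_of_mem_imagePhi {P : State I → ℝ}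
    (hP : P ∈ imagePhi (cliqueMatrix G I)) : GlobalMarkov G P := by
  obtain ⟨t, -, rfl⟩ := hP
  intro A B S hs r r' hS
  simp only [phi_cliqueMatrix, ← Finset.prod_mul_distrib]
  refine Finset.prod_congr rfl fun C _ => ?_
  rcases hs.clique_swap hS C.2.1 with ⟨h1, h2⟩ | ⟨h1, h2⟩
  · congr 3 <;> funext v
    · exact (h1 v v.2).symm
    · exact (h2 v v.2).symm
  · rw [mul_comm]
    congr 3 <;> funext v
    · exact (h1 v v.2).symm
    · exact (h2 v v.2).symm

end Clique

end

/-! ### Perfect elimination orderings -/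

section

open MvPolynomial Filter Topology

section Elimination

variable {V : Type u} [Fintype V] [DecidableEq V] {G : SimpleGraph V}
  {I : V → Type w} [∀ v, Fintype (I v)] [∀ v, DecidableEq (I v)]

/-- The vertices, listed by increasing position, form a perfect elimination ordering: the earlier
neighbours of each vertex are pairwise adjacent. -/
def IsPerfectElimination (G : SimpleGraph V) (pos : V → ℕ) : Prop :=
  Function.Injective pos ∧ ∀ v a b, G.Adj v a → G.Adj v b → pos a < pos v → pos b < pos v →
    a ≠ b → G.Adj a b

open Classical in
/-- The earlier neighbours of a vertex. -/
def parents (G : SimpleGraph V) (pos : V → ℕ) (v : V) : Finset V :=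
  {w | G.Adj v w ∧ pos w < pos v}

/-- A vertex together with its earlier neighbours. -/
def family (G : SimpleGraph V) (pos : V → ℕ) (v : V) : Finset V :=
  insert v (parents G pos v)

/-- The vertices at positions less than `k`. -/
def before (pos : V → ℕ) (k : ℕ) : Finset V := {w | pos w < k}

variable {pos : V → ℕ}

theorem mem_parents {v w : V} : w ∈ parents G pos v ↔ G.Adj v w ∧ pos w < pos v := by
  simp [parents]

theorem mem_before {k : ℕ} {w : V} : w ∈ before pos k ↔ pos w < k := by
  simp [before]

theorem IsPerfectElimination.isClique_parents (h : IsPerfectElimination G pos) (v : V) :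
    G.IsClique (parents G pos v : Set V) := by
  intro a ha b hb hab
  simp only [Finset.mem_coe, mem_parents] at ha hb
  exact h.2 v a b ha.1 hb.1 ha.2 hb.2 hab

theorem IsPerfectElimination.isClique_family (h : IsPerfectElimination G pos) (v : V) :
    G.IsClique (family G pos v : Set V) := by
  rw [family, Finset.coe_insert, SimpleGraph.isClique_insert]
  refine ⟨h.isClique_parents v, fun b hb _ => ?_⟩
  exact (mem_parents.1 (Finset.mem_coe.1 hb)).1

/-- The earlier neighbours of `v` separate `v` from all other earlier vertices in the whole graph.
The side of `v` consists of the vertices that paths of increasing position reach from `v`. -/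
theorem IsPerfectElimination.exists_separation (h : IsPerfectElimination G pos) (v : V) :
    ∃ A B : Finset V, SaturatedSeparation G A B (parents G pos v) ∧ v ∈ A ∧
      (∀ w, pos w < pos v → w ∉ A) ∧ ∀ w, pos w < pos v → w ∉ parents G pos v → w ∈ B := by
  classical
  let R : V → V → Prop := fun x y => G.Adj x y ∧ pos x < pos y
  let A : Finset V := {w | Relation.ReflTransGen R v w}
  have hA : ∀ w, w ∈ A ↔ Relation.ReflTransGen R v w := fun w => by simp [A]
  have hpos : ∀ w, w ∈ A → pos v ≤ pos w := by
    intro w hw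
    induction (hA w).1 hw with
    | refl => exact le_rfl
    | @tail b c hb hbc ih => exact (ih ((hA b).2 hb)).trans hbc.2.le
  have hpar : ∀ w, Relation.ReflTransGen R v w → ∀ z, z ∉ A → G.Adj w z →
      z ∈ parents G pos v := by
    intro w hw
    have hlt : ∀ w, Relation.ReflTransGen R v w → ∀ z, z ∉ A → G.Adj w z → pos z < pos w := by
      intro w hw z hz hwz
      rcases lt_trichotomy (pos z) (pos w) with hlt | heq | hgt
      · exact hlt
      · exact absurd (h.1 heq) hwz.ne'
      · exact absurd ((hA z).2 (hw.tail ⟨hwz, hgt⟩)) hz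
    induction hw with
    | refl => exact fun z hz hvz => mem_parents.2 ⟨hvz, hlt v .refl z hz hvz⟩
    | @tail b c hb hbc ih =>
      intro z hz hcz
      refine ih z hz (h.2 c b z hbc.1.symm hcz hbc.2 (hlt c (hb.tail hbc) z hz hcz) ?_)
      rintro rfl
      exact hz ((hA _).2 hb)
  refine ⟨A, (A ∪ parents G pos v)ᶜ, saturatedSeparation_of_not_adj ?_ ?_ ?_ ?_ ?_,
    (hA v).2 .refl, fun w hw hwA => absurd (hpos w hwA) (not_le.2 hw), fun w hw hwp => ?_⟩
  · rw [Finset.disjoint_left]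
    intro a ha
    simp [ha]
  · rw [Finset.disjoint_left]
    intro a ha hap
    exact absurd (mem_parents.1 hap).2 (not_lt.2 (hpos a ha))
  · rw [Finset.disjoint_left]
    intro a ha
    simp only [Finset.mem_compl, Finset.mem_union, not_or] at ha
    exact ha.2
  · ext a
    simp only [Finset.mem_union, Finset.mem_compl, Finset.mem_univ, iff_true]
    tauto
  · intro a ha b hb hab
    simp only [Finset.mem_compl, Finset.mem_union, not_or] at hb
    exact hb.2 (hpar a ((hA a).1 ha) b hb.1 hab)
  · simp only [Finset.mem_compl, Finset.mem_union, not_or]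
    exact ⟨fun hwA => absurd (hpos w hwA) (not_le.2 hw), hwp⟩

/-- The marginal of the table `p` for the variables in `D`, at the levels of the cell `x`. -/
def marg {M : Type*} [AddCommMonoid M] (D : Finset V) (p : State I → M) (x : State I) : M :=
  ∑ y with ∀ v ∈ D, y v = x v, p y

theorem marg_congr {M : Type*} [AddCommMonoid M] (D : Finset V) (p : State I → M) :
    DependsOnlyOn D (marg D p) := by
  intro x y h
  unfold marg
  congr 1
  ext z
  simp only [Finset.mem_filter, Finset.mem_univ, true_and]
  exact forall₂_congr fun v hv => by rw [h v hv]

theorem marg_univ {M : Type*} [AddCommMonoid M] {D : Finset V} (hD : ∀ v, v ∈ D)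
    (p : State I → M) (x : State I) : marg D p x = p x := by
  unfold marg
  rw [Finset.sum_eq_single_of_mem x (by simp)]
  intro y hy hyx
  exact absurd (funext fun v => (Finset.mem_filter.1 hy).2 v (hD v)) hyx

theorem marg_empty {M : Type*} [AddCommMonoid M] (p : State I → M) (x : State I) :
    marg ∅ p x = ∑ y, p y := by
  simp [marg]

/-- A signed table with vanishing marginals on the maximal cliques has vanishing marginals on all
cliques. -/
theorem marg_eq_zero_of_clique {d : State I → ℝ}
    (hd : ∀ r, ∑ x, (cliqueMatrix G I r x : ℝ) * d x = 0) {D : Finset V}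
    (hD : G.IsClique (D : Set V)) (x : State I) : marg D d x = 0 := by
  have := sum_mul_eq_zero_of_clique hd hD (h := fun y => if ∀ v ∈ D, y v = x v then 1 else 0)
    fun y z hyz => by
      have : (∀ v ∈ D, y v = x v) ↔ ∀ v ∈ D, z v = x v :=
        forall₂_congr fun v hv => by rw [hyz v hv]
      simp only [this]
  simp only [ite_mul, one_mul, zero_mul, ← Finset.sum_filter] at this
  exact this

theorem marg_nonneg {D : Finset V} {p : State I → ℝ} (hp : ∀ y, 0 ≤ p y) (x : State I) :
    0 ≤ marg D p x :=
  Finset.sum_nonneg fun y _ => hp y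

theorem marg_le_marg {D E : Finset V} (hDE : D ⊆ E) {p : State I → ℝ} (hp : ∀ y, 0 ≤ p y)
    (x : State I) : marg E p x ≤ marg D p x := by
  refine Finset.sum_le_sum_of_subset_of_nonneg ?_ fun y _ _ => hp y
  intro y hy
  simp only [Finset.mem_filter, Finset.mem_univ, true_and] at hy ⊢
  exact fun v hv => hy v (hDE hv)

theorem before_succ (h : Function.Injective pos) (v : V) :
    before pos (pos v + 1) = insert v (before pos (pos v)) := by
  ext w
  simp only [mem_before, Finset.mem_insert, Nat.lt_succ_iff_lt_or_eq]
  constructor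
  · rintro (hw | hw)
    · exact Or.inr hw
    · exact Or.inl (h hw)
  · rintro (rfl | hw)
    · exact Or.inr rfl
    · exact Or.inl hw

/-- For a globally Markov table, `v` is independent of the earlier vertices given its earlier
neighbours. The proof matches the pairs of cells counted on the two sides by exchanging the levels
on the side of `v`. -/
theorem marg_before_succ_mul (h : IsPerfectElimination G pos) {P : State I → ℝ}
    (hP : GlobalMarkov G P) (v : V) (x : State I) :
    marg (before pos (pos v + 1)) P x * marg (parents G pos v) P x =
      marg (family G pos v) P x * marg (before pos (pos v)) P x := by
  obtain ⟨A, B, hs, hvA, hA, -⟩ := h.exists_separation v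
  have hpA : ∀ w ∈ parents G pos v, w ∉ A := fun w hw => hA w (mem_parents.1 hw).2
  unfold marg
  simp only [Finset.sum_mul_sum, ← Finset.sum_product', before_succ h.1, family,
    Finset.forall_mem_insert]
  refine Finset.sum_nbij' (fun q => (A.piecewise q.1 q.2, A.piecewise q.2 q.1))
    (fun q => (A.piecewise q.1 q.2, A.piecewise q.2 q.1)) ?_ ?_ ?_ ?_ ?_
  · rintro ⟨y, z⟩ hyz
    simp only [Finset.mem_product, Finset.mem_filter, Finset.mem_univ, true_and] at hyz ⊢
    obtain ⟨⟨h1, h2⟩, h3⟩ := hyz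
    refine ⟨⟨by simp [hvA, h1], fun w hw => by simp [hpA w hw, h3 w hw]⟩, fun w hw => ?_⟩
    simp [hA w (mem_before.1 hw), h2 w hw]
  · rintro ⟨y, z⟩ hyz
    simp only [Finset.mem_product, Finset.mem_filter, Finset.mem_univ, true_and] at hyz ⊢
    obtain ⟨⟨h1, h2⟩, h3⟩ := hyz
    refine ⟨⟨by simp [hvA, h1], fun w hw => ?_⟩, fun w hw => by simp [hpA w hw, h2 w hw]⟩
    simp [hA w (mem_before.1 hw), h3 w hw]
  · rintro ⟨y, z⟩ -
    simp only [Prod.mk.injEq]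
    constructor <;> funext w <;> by_cases hw : w ∈ A <;> simp [hw]
  · rintro ⟨y, z⟩ -
    simp only [Prod.mk.injEq]
    constructor <;> funext w <;> by_cases hw : w ∈ A <;> simp [hw]
  · rintro ⟨y, z⟩ hyz
    simp only [Finset.mem_product, Finset.mem_filter, Finset.mem_univ, true_and] at hyz
    obtain ⟨⟨h1, h2⟩, h3⟩ := hyz
    dsimp only
    rw [hP A B _ hs y z fun w hw => ?_, mul_comm]
    rw [h3 w hw, h2 w (mem_before.2 (mem_parents.1 hw).2)]

/-- A nonnegative globally Markov table is the product of its total and of the conditional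
probabilities of the vertices given their earlier neighbours. The quotients `0 / 0 = 0` do no
harm: where one occurs, the entry of the table vanishes. -/
theorem eq_prod_marg (h : IsPerfectElimination G pos) {P : State I → ℝ}
    (hP : GlobalMarkov G P) (h0 : ∀ x, 0 ≤ P x) (x : State I) :
    P x = (∑ y, P y) * ∏ v, (marg (family G pos v) P x / marg (parents G pos v) P x) := by
  have key : ∀ k, marg (before pos k) P x = (∑ y, P y) *
      ∏ v ∈ before pos k, (marg (family G pos v) P x / marg (parents G pos v) P x) := by
    intro k
    induction k with
    | zero =>
      have : before pos 0 = ∅ := by ext w; simp [mem_before]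
      simp [this, marg_empty]
    | succ k ih =>
      by_cases hk : ∃ v, pos v = k
      · obtain ⟨v, rfl⟩ := hk
        have hv : v ∉ before pos (pos v) := by simp [mem_before]
        rw [before_succ h.1, Finset.prod_insert hv, mul_left_comm, ← ih, ← before_succ h.1]
        have hmul := marg_before_succ_mul h hP v x
        by_cases hz : marg (parents G pos v) P x = 0
        · rw [hz, div_zero, zero_mul]
          refine le_antisymm (hz ▸ marg_le_marg (fun w hw => ?_) h0 x) (marg_nonneg h0 x)
          exact mem_before.2 ((mem_parents.1 hw).2.trans (Nat.lt_succ_self _))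
        · rw [div_mul_eq_mul_div, eq_div_iff hz, hmul]
      · have : before pos (k + 1) = before pos k := by
          ext w
          simp only [mem_before, Nat.lt_succ_iff_lt_or_eq]
          exact ⟨fun hw => hw.resolve_right fun hw => hk ⟨w, hw⟩, Or.inl⟩
        rw [this, ih]
  obtain ⟨N, hN⟩ : ∃ N, ∀ v, pos v < N := by
    obtain ⟨N, hN⟩ := (Set.finite_range pos).bddAbove
    exact ⟨N + 1, fun v => Nat.lt_succ_of_le (hN ⟨v, rfl⟩)⟩
  have hall : ∀ v, v ∈ before pos N := fun v => mem_before.2 (hN v)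
  have := key N
  rwa [marg_univ hall, Finset.eq_univ_of_forall hall] at this

variable [∀ v, Nonempty (I v)]

/-- A Markov table factors when the graph has a perfect elimination ordering: the conditional
probabilities are the potentials. -/
theorem GlobalMarkov.mem_imagePhi (h : IsPerfectElimination G pos) {P : State I → ℝ}
    (hP : GlobalMarkov G P) (h0 : ∀ x, 0 ≤ P x) : P ∈ imagePhi (cliqueMatrix G I) := by
  have : P = fun x => (∑ y, P y) *
      ∏ v, (marg (family G pos v) P x / marg (parents G pos v) P x) :=
    funext (eq_prod_marg h hP h0)
  rw [this]
  refine mul_mem_imagePhi (const_mem_imagePhi (Finset.sum_nonneg fun y _ => h0 y))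
    (prod_mem_imagePhi _ _ fun v _ => mem_imagePhi_of_clique (h.isClique_family v)
      (fun x => div_nonneg (marg_nonneg h0 x) (marg_nonneg h0 x)) fun x y hxy => ?_)
  rw [marg_congr _ P x y hxy, marg_congr _ P x y fun v hv => hxy v (Finset.mem_insert_of_mem hv)]

theorem mem_factoring_iff_of_perfectElimination (h : IsPerfectElimination G pos)
    {P : State I → ℝ} (hP : P ∈ stdSimplex ℝ (State I)) :
    P ∈ factoring (cliqueMatrix G I) ↔ ∀ f ∈ globalBinomials G I, eval P f = 0 := by
  rw [← globalMarkov_iff]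
  exact ⟨fun hf => globalMarkov_of_mem_imagePhi hf.1,
    fun hm => ⟨hm.mem_imagePhi h hP.1, hP⟩⟩

/-! ### From binomial equations to closedness -/

theorem eval_smul_globalBinomial {f : MvPolynomial (State I) ℝ} (hf : f ∈ globalBinomials G I)
    (c : ℝ) (P : State I → ℝ) : eval (fun x => c * P x) f = c ^ 2 * eval P f := by
  obtain ⟨A, B, S, -, x, x', y, y', z, -, -, rfl⟩ := hf
  simp only [cpd, map_sub, map_mul, eval_X]
  ring

/-- If binomials of separation statements cut out the factoring distributions, then, being
homogeneous, they cut out the image of the monomial map in the nonnegative orthant. -/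
theorem isClosed_imagePhi_of_binomials {B : Set (MvPolynomial (State I) ℝ)}
    (hB : B ⊆ globalBinomials G I)
    (h : ∀ P ∈ stdSimplex ℝ (State I), (P ∈ factoring (cliqueMatrix G I) ↔
      ∀ f ∈ B, eval P f = 0)) : IsClosed (imagePhi (cliqueMatrix G I)) := by
  have key : imagePhi (cliqueMatrix G I) =
      {p | (∀ x, 0 ≤ p x) ∧ ∀ f ∈ B, eval p f = 0} := by
    ext p
    constructor
    · intro hp
      refine ⟨nonneg_of_mem_imagePhi hp, fun f hf => ?_⟩
      exact (globalMarkov_iff p).1 (globalMarkov_of_mem_imagePhi hp) f (hB hf)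
    · rintro ⟨h0, hf⟩
      rcases (Finset.sum_nonneg fun y (_ : y ∈ Finset.univ) => h0 y).eq_or_lt with hs | hs
      · have : p = fun _ => 0 := funext fun x =>
          (Finset.sum_eq_zero_iff_of_nonneg fun y _ => h0 y).1 hs.symm x (Finset.mem_univ x)
        rw [this]
        exact const_mem_imagePhi le_rfl
      · set s := ∑ y, p y
        have hq : (fun x => s⁻¹ * p x) ∈ stdSimplex ℝ (State I) :=
          ⟨fun x => mul_nonneg (inv_nonneg.2 hs.le) (h0 x), by
            rw [← Finset.mul_sum, inv_mul_cancel₀ hs.ne']⟩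
        have hq' := ((h _ hq).2 fun f hfB => by
          rw [eval_smul_globalBinomial (hB hfB), hf f hfB, mul_zero]).1
        have := mul_mem_imagePhi (const_mem_imagePhi hs.le) hq'
        simpa [mul_inv_cancel_left₀ hs.ne'] using this
  rw [key]
  have : {p : State I → ℝ | (∀ x, 0 ≤ p x) ∧ ∀ f ∈ B, eval p f = 0} =
      (⋂ x, {p | 0 ≤ p x}) ∩ ⋂ f ∈ B, {p | eval p f = 0} := by
    ext p; simp
  rw [this]
  refine IsClosed.inter (isClosed_iInter fun x => isClosed_le continuous_const
    (continuous_apply x)) (isClosed_biInter fun f _ => isClosed_eq ?_ continuous_const)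
  exact MvPolynomial.continuous_eval f

end Elimination

end

/-! ### Maximum likelihood in the extended model -/

section

open MvPolynomial Filter Topology

section Likelihood

variable {R C : Type*} [Fintype R] [Fintype C] {A : Matrix R C ℕ}

theorem extendedModel_subset_stdSimplex : extendedModel A ⊆ stdSimplex ℝ C :=
  closure_minimal Set.inter_subset_right (isClosed_stdSimplex ℝ C)

theorem isCompact_extendedModel : IsCompact (extendedModel A) :=
  (isCompact_stdSimplex (𝕜 := ℝ) (ι := C)).of_isClosed_subset isClosed_closure
    extendedModel_subset_stdSimplex

theorem continuous_likelihood (u : C → ℕ) : Continuous (likelihood u) :=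
  continuous_finsetProd _ fun x _ => (continuous_apply x).pow _

theorem uniform_mem_factoring [Nonempty C] (hA : ∀ c : ℝ, 0 ≤ c → (fun _ => c) ∈ imagePhi A) :
    (fun _ => (Fintype.card C : ℝ)⁻¹) ∈ factoring A :=
  ⟨hA _ (by positivity), fun _ => by positivity, by simp⟩

theorem exists_isMLE [Nonempty C] (hA : ∀ c : ℝ, 0 ≤ c → (fun _ => c) ∈ imagePhi A)
    (u : C → ℕ) : ∃ p, IsMLE A u p := by
  obtain ⟨p, hp, hmax⟩ := (isCompact_extendedModel (A := A)).exists_isMaxOn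
    ⟨_, subset_closure (uniform_mem_factoring hA)⟩ (continuous_likelihood u).continuousOn
  exact ⟨p, hp, hmax⟩

theorem reweight_mem_extendedModel (hA : ∀ c : ℝ, 0 ≤ c → (fun _ => c) ∈ imagePhi A)
    {p : C → ℝ} (hp : p ∈ extendedModel A) {w : C → ℝ} (hw : w ∈ imagePhi A)
    (hw0 : ∀ x, 0 < w x) : (fun x => (∑ y, w y * p y)⁻¹ * (w x * p x)) ∈ extendedModel A := by
  have hpos : ∀ q ∈ stdSimplex ℝ C, 0 < ∑ y, w y * q y := by
    rintro q ⟨h0, h1⟩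
    obtain ⟨x, hx⟩ : ∃ x, 0 < q x := by
      by_contra! hcon
      have : ∑ x, q x ≤ 0 := Finset.sum_nonpos fun x _ => hcon x
      linarith
    exact Finset.sum_pos' (fun y _ => mul_nonneg (hw0 y).le (h0 y))
      ⟨x, Finset.mem_univ x, mul_pos (hw0 x) hx⟩
  have hp' := extendedModel_subset_stdSimplex hp
  refine ContinuousWithinAt.mem_closure (s := factoring A)
    (f := fun p x => (∑ y, w y * p y)⁻¹ * (w x * p x)) (ContinuousAt.continuousWithinAt ?_) hp ?_
  · refine continuousAt_pi.2 fun x => ContinuousAt.mul (ContinuousAt.inv₀ ?_ (hpos p hp').ne') ?_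
    · exact (continuous_finsetSum _ fun y _ =>
        continuous_const.mul (continuous_apply y)).continuousAt
    · exact (continuous_const.mul (continuous_apply x)).continuousAt
  · rintro q ⟨hq, hq1⟩
    refine ⟨mul_mem_imagePhi (hA _ (inv_nonneg.2 (hpos q hq1).le)) (mul_mem_imagePhi hw hq),
      fun x => mul_nonneg (inv_nonneg.2 (hpos q hq1).le) (mul_nonneg (hw0 x).le (hq1.1 x)), ?_⟩
    rw [← Finset.mul_sum, inv_mul_cancel₀ (hpos q hq1).ne']

/-- The likelihood equations: the sufficient statistics of a maximum likelihood estimate are those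
of the empirical distribution. They are the first-order condition along the exponential tilts of
the estimate in the direction of a row of `A`. -/
theorem IsMLE.marginals_eq [Nonempty C] (hA : ∀ c : ℝ, 0 ≤ c → (fun _ => c) ∈ imagePhi A)
    {u : C → ℕ} {p : C → ℝ} (h : IsMLE A u p) (i : R) :
    (∑ x, (u x : ℝ)) * ∑ x, (A i x : ℝ) * p x = ∑ x, (A i x : ℝ) * u x := by
  classical
  obtain ⟨hp, hmax⟩ := h
  have hp' := extendedModel_subset_stdSimplex hp
  have hL : 0 < likelihood u p := by
    refine lt_of_lt_of_le ?_ (hmax _ (subset_closure (uniform_mem_factoring hA)))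
    exact Finset.prod_pos fun x _ => pow_pos (inv_pos.2 (by exact_mod_cast Fintype.card_pos)) _
  set N := ∑ x, u x
  set a := ∑ x, A i x * u x
  let Z : ℝ → ℝ := fun τ => ∑ x, Real.exp τ ^ A i x * p x
  have hZ0 : Z 0 = 1 := by simp [Z, hp'.2]
  have hineq : ∀ τ, Real.exp τ ^ a ≤ Z τ ^ N := by
    intro τ
    have hw : (fun x => Real.exp τ ^ A i x) ∈ imagePhi A := by
      refine ⟨fun j => if j = i then Real.exp τ else 1, fun j => ?_, ?_⟩
      · dsimp only; split_ifs <;> positivity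
      · funext x
        simp [phi, ite_pow]
    have hZ : 0 < Z τ := by
      obtain ⟨x, hx⟩ : ∃ x, 0 < p x := by
        by_contra! hcon
        have : ∑ x, p x ≤ 0 := Finset.sum_nonpos fun x _ => hcon x
        linarith [hp'.2]
      exact Finset.sum_pos' (fun y _ => mul_nonneg (by positivity) (hp'.1 y))
        ⟨x, Finset.mem_univ x, mul_pos (by positivity) hx⟩
    have := hmax _ (reweight_mem_extendedModel hA hp hw fun x => by positivity)
    have heq : likelihood u (fun x => (∑ y, Real.exp τ ^ A i y * p y)⁻¹ *
        (Real.exp τ ^ A i x * p x)) = (Z τ ^ N)⁻¹ * (Real.exp τ ^ a * likelihood u p) := by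
      simp only [likelihood, mul_pow, Finset.prod_mul_distrib, Finset.prod_pow_eq_pow_sum, N, a,
        Z, ← pow_mul]
      rw [inv_pow]
    rw [heq, ← mul_assoc] at this
    have h2 := le_of_mul_le_mul_right (by linarith : (Z τ ^ N)⁻¹ * Real.exp τ ^ a *
      likelihood u p ≤ 1 * likelihood u p) hL
    rwa [inv_mul_le_iff₀ (pow_pos hZ _), mul_one] at h2
  have hmin : IsLocalMin (fun τ => Z τ ^ N - Real.exp τ ^ a) 0 := by
    refine Filter.Eventually.of_forall fun τ => ?_
    simp only [hZ0, Real.exp_zero, one_pow, sub_self]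
    linarith [hineq τ]
  have hexp : ∀ k : ℕ, HasDerivAt (fun τ => Real.exp τ ^ k) (k : ℝ) 0 := by
    intro k
    simpa using (Real.hasDerivAt_exp 0).fun_pow k
  have hZ' : HasDerivAt Z (∑ x, (A i x : ℝ) * p x) 0 :=
    HasDerivAt.fun_sum fun x _ => (hexp (A i x)).mul_const (p x)
  have hder := hmin.hasDerivAt_eq_zero ((hZ'.fun_pow N).sub (hexp a))
  rw [hZ0, one_pow, mul_one, sub_eq_zero] at hder
  simpa [N, a] using hder

/-- The positive members of the exponential family of `A`, up to normalization. -/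
def logLinear (A : Matrix R C ℕ) : Set (C → ℝ) :=
  {p | (∀ x, 0 < p x) ∧ ∃ (l : R → ℝ) (c : ℝ), ∀ x, Real.log (p x) = ∑ i, A i x * l i + c}

theorem extendedModel_subset_closure_logLinear : extendedModel A ⊆ closure (logLinear A) := by
  refine closure_minimal ?_ isClosed_closure
  rintro p ⟨⟨t, ht, rfl⟩, hp⟩
  have hcont : ContinuousWithinAt (fun (ε : ℝ) x => phi A (fun i => t i + ε) x) (Set.Ioi 0) 0 := by
    refine Continuous.continuousWithinAt ?_
    unfold phi
    fun_prop
  have h0 : (0 : ℝ) ∈ closure (Set.Ioi (0 : ℝ)) := by simp [closure_Ioi]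
  have := hcont.mem_closure (t := logLinear A) h0 fun ε (hε : 0 < ε) => by
    have hpos : ∀ i, 0 < t i + ε := fun i => add_pos_of_nonneg_of_pos (ht i) hε
    refine ⟨fun x => Finset.prod_pos fun i _ => pow_pos (hpos i) _, fun i => Real.log (t i + ε), 0,
      fun x => ?_⟩
    simp only [phi]
    rw [Real.log_prod fun i _ => (pow_pos (hpos i) _).ne', add_zero]
    exact Finset.sum_congr rfl fun i _ => Real.log_pow _ _
  simpa using this

/-- A distribution in the extended model is determined by its sufficient statistics. The
difference `p - q` is orthogonal to `log p' - log q'` for log-linear `p'`, `q'`; taking these close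
to `p`, `q` makes every term of that sum nonnegative, and positive where `p` and `q` differ. -/
theorem eq_of_marginals_eq {p q : C → ℝ} (hp : p ∈ extendedModel A) (hq : q ∈ extendedModel A)
    (h : ∀ i, ∑ x, (A i x : ℝ) * p x = ∑ x, (A i x : ℝ) * q x) : p = q := by
  have hp1 := (extendedModel_subset_stdSimplex hp).2
  have hq1 := (extendedModel_subset_stdSimplex hq).2
  have side : ∀ p q : C → ℝ, p ∈ extendedModel A → ∃ p' ∈ logLinear A,
      ∀ x, (q x < p x → (p x + q x) / 2 < p' x) ∧ (p x < q x → p' x < (p x + q x) / 2) := by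
    intro p q hp
    have hev : ∀ᶠ p' in 𝓝 p, ∀ x, (q x < p x → (p x + q x) / 2 < p' x) ∧
        (p x < q x → p' x < (p x + q x) / 2) := by
      refine eventually_all.2 fun x => ?_
      have hx : Tendsto (fun p' : C → ℝ => p' x) (𝓝 p) (𝓝 (p x)) :=
        (continuous_apply x).tendsto p
      refine Eventually.and ?_ ?_
      · by_cases hlt : q x < p x
        · filter_upwards [hx.eventually_const_lt (show (p x + q x) / 2 < p x by linarith)]
            with p' h _ using h
        · exact .of_forall fun _ h => absurd h hlt
      · by_cases hlt : p x < q x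
        · filter_upwards [hx.eventually_lt_const (show p x < (p x + q x) / 2 by linarith)]
            with p' h _ using h
        · exact .of_forall fun _ h => absurd h hlt
    obtain ⟨p', h1, h2⟩ := mem_closure_iff_nhds.1
      (extendedModel_subset_closure_logLinear hp) _ hev
    exact ⟨p', h2, h1⟩
  obtain ⟨p', ⟨hp0, l, c, hl⟩, hpx⟩ := side p q hp
  obtain ⟨q', ⟨hq0, m, e, hm⟩, hqx⟩ := side q p hq
  have hsum : ∑ x, (p x - q x) * (Real.log (p' x) - Real.log (q' x)) = 0 := by
    have hlin : ∀ (l : R → ℝ) (c : ℝ), ∑ x, (p x - q x) * (∑ i, A i x * l i + c) = 0 := by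
      intro l c
      simp only [mul_add, Finset.sum_add_distrib, Finset.mul_sum, ← Finset.sum_mul]
      rw [Finset.sum_comm, Finset.sum_eq_zero fun i _ => ?_, Finset.sum_sub_distrib, hp1, hq1]
      · simp
      · have : ∀ x, (p x - q x) * ((A i x : ℝ) * l i) =
            l i * (A i x * p x) - l i * (A i x * q x) := fun x => by ring
        simp only [this, Finset.sum_sub_distrib, ← Finset.mul_sum, h i, sub_self]
    simp only [mul_sub, Finset.sum_sub_distrib, hl, hm, hlin, sub_self]
  have hterm : ∀ x, 0 ≤ (p x - q x) * (Real.log (p' x) - Real.log (q' x)) ∧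
      (p x ≠ q x → 0 < (p x - q x) * (Real.log (p' x) - Real.log (q' x))) := by
    intro x
    rcases lt_trichotomy (p x) (q x) with hlt | heq | hgt
    · have h1 := (hpx x).2 hlt
      have h2 := (hqx x).1 hlt
      have := Real.log_lt_log (hp0 x) (show p' x < q' x by linarith)
      have := mul_pos_of_neg_of_neg (sub_neg.2 hlt) (sub_neg.2 this)
      exact ⟨this.le, fun _ => this⟩
    · exact ⟨by simp [heq], fun hne => absurd heq hne⟩
    · have h1 := (hpx x).1 hgt
      have h2 := (hqx x).2 hgt
      have := Real.log_lt_log (hq0 x) (show q' x < p' x by linarith)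
      have := mul_pos (sub_pos.2 hgt) (sub_pos.2 this)
      exact ⟨this.le, fun _ => this⟩
  funext x
  by_contra hne
  exact absurd hsum (Finset.sum_pos' (fun x _ => (hterm x).1)
    ⟨x, Finset.mem_univ x, (hterm x).2 hne⟩).ne'

end Likelihood

section RationalMLE

variable {V : Type u} [Fintype V] [DecidableEq V] {G : SimpleGraph V}
  {I : V → Type w} [∀ v, Fintype (I v)] [∀ v, DecidableEq (I v)] [∀ v, Nonempty (I v)]

theorem globalMarkov_of_mem_extendedModel {P : State I → ℝ}
    (hP : P ∈ extendedModel (cliqueMatrix G I)) : GlobalMarkov G P := by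
  rw [globalMarkov_iff]
  have hcl : IsClosed {p : State I → ℝ | ∀ f ∈ globalBinomials G I, eval p f = 0} := by
    have : {p : State I → ℝ | ∀ f ∈ globalBinomials G I, eval p f = 0} =
        ⋂ f ∈ globalBinomials G I, {p | eval p f = 0} := by
      ext p; simp
    rw [this]
    exact isClosed_biInter fun f _ => isClosed_eq (MvPolynomial.continuous_eval f)
      continuous_const
  exact closure_minimal (fun p hp => (globalMarkov_iff p).1
    (globalMarkov_of_mem_imagePhi hp.1)) hcl hP

theorem IsMLE.marg_eq {u : State I → ℕ} (hu : u ≠ 0) {p : State I → ℝ}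
    (h : IsMLE (cliqueMatrix G I) u p) {D : Finset V} (hD : G.IsClique (D : Set V))
    (x : State I) : marg D p x = marg D (fun y => (u y : ℝ)) x / ∑ y, (u y : ℝ) := by
  have hN : (∑ y, (u y : ℝ)) ≠ 0 := by
    obtain ⟨y, hy⟩ := Function.ne_iff.1 hu
    exact (Finset.sum_pos' (fun y _ => Nat.cast_nonneg (u y))
      ⟨y, Finset.mem_univ y, by exact_mod_cast Nat.pos_of_ne_zero hy⟩).ne'
  rw [eq_div_iff hN]
  have := marg_eq_zero_of_clique (G := G) (I := I)
    (d := fun y => p y * (∑ y, (u y : ℝ)) - u y) (fun r => ?_) hD x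
  · simp only [marg, Finset.sum_sub_distrib, ← Finset.sum_mul] at this
    exact sub_eq_zero.1 this
  · have := h.marginals_eq (fun c => const_mem_imagePhi) r
    simp only [mul_sub, Finset.sum_sub_distrib, ← mul_assoc, ← Finset.sum_mul]
    rw [mul_comm, this, sub_self]

/-- With a perfect elimination ordering, the maximum likelihood estimate is the product of the
empirical conditional probabilities of the vertices given their earlier neighbours. -/
theorem mleIsRational_of_perfectElimination {pos : V → ℕ} (h : IsPerfectElimination G pos)
    (K : Subfield ℝ) : MLEIsRational (cliqueMatrix G I) K := by
  have haeval : ∀ (u : State I → ℝ) (D : Finset V) (x : State I),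
      aeval u (marg D (X : State I → MvPolynomial (State I) K) x) = marg D u x := by
    intro u D x
    simp [marg]
  refine ⟨fun x => ∏ v, marg (family G pos v) X x, fun x => ∏ v, marg (parents G pos v) X x,
    fun x hx => ?_, fun u hu _ p => ?_⟩
  · have := congrArg (aeval (fun _ : State I => (1 : ℝ))) hx
    rw [map_prod, map_zero, Finset.prod_eq_zero_iff] at this
    obtain ⟨v, -, hv⟩ := this
    rw [haeval] at hv
    have hpos : 0 < marg (parents G pos v) (fun _ : State I => (1 : ℝ)) x := by
      unfold marg
      exact Finset.sum_pos (fun _ _ => one_pos) ⟨x, by simp⟩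
    exact hpos.ne' hv
  · have key : ∀ q, IsMLE (cliqueMatrix G I) u q → ∀ x,
        q x = aeval (fun y => (u y : ℝ)) (∏ v, marg (family G pos v)
          (X : State I → MvPolynomial (State I) K) x) /
          aeval (fun y => (u y : ℝ)) (∏ v, marg (parents G pos v)
          (X : State I → MvPolynomial (State I) K) x) := by
      intro q hq x
      have hq' := extendedModel_subset_stdSimplex hq.1
      rw [eq_prod_marg h (globalMarkov_of_mem_extendedModel hq.1) hq'.1 x, hq'.2, one_mul]
      simp only [map_prod, haeval]
      rw [← Finset.prod_div_distrib]
      refine Finset.prod_congr rfl fun v _ => ?_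
      rw [hq.marg_eq hu (h.isClique_family v), hq.marg_eq hu (h.isClique_parents v)]
      refine div_div_div_cancel_right₀ ?_ _ _
      obtain ⟨y, hy⟩ := Function.ne_iff.1 hu
      exact (Finset.sum_pos' (fun y _ => Nat.cast_nonneg (u y))
        ⟨y, Finset.mem_univ y, by exact_mod_cast Nat.pos_of_ne_zero hy⟩).ne'
    refine ⟨key p, fun hp => ?_⟩
    obtain ⟨q, hq⟩ := exists_isMLE (A := cliqueMatrix G I) (fun c => const_mem_imagePhi) u
    have hpq : p = q := by
      funext x
      rw [key q hq x]
      exact hp x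
    rw [hpq]
    exact hq

end RationalMLE

end

/-! ### A criterion for Gröbner bases of toric ideals -/

section

open MvPolynomial Filter Topology
open scoped MonomialOrder

section Groebner

variable {R C : Type*} [Fintype R] [Fintype C] {A : Matrix R C ℕ}

/-- The exponent `A u` of the monomial in the row variables that corresponds to `p ^ u`. -/
def rowExponent (A : Matrix R C ℕ) (u : C →₀ ℕ) : R →₀ ℕ :=
  Finsupp.equivFunOnFinite.symm (A.mulVec u)

theorem rowExponent_inj {u v : C →₀ ℕ} :
    rowExponent A u = rowExponent A v ↔ A.mulVec u = A.mulVec v :=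
  Finsupp.equivFunOnFinite.symm.injective.eq_iff

/-- The algebra homomorphism `p_x ↦ ∏ i, t_i ^ A i x`, whose kernel contains the toric ideal. -/
def monomialHom (A : Matrix R C ℕ) : MvPolynomial C ℝ →ₐ[ℝ] MvPolynomial R ℝ :=
  aeval fun x => ∏ i, X i ^ A i x

theorem monomialHom_monomial (u : C →₀ ℕ) (c : ℝ) :
    monomialHom A (monomial u c) = monomial (rowExponent A u) c := by
  rw [monomialHom, aeval_monomial, monomial_eq, algebraMap_eq]
  congr 1
  rw [Finsupp.prod_fintype _ _ (by simp), Finsupp.prod_fintype _ _ (by simp)]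
  simp only [← Finset.prod_pow, ← pow_mul]
  rw [Finset.prod_comm]
  refine Finset.prod_congr rfl fun i _ => ?_
  rw [Finset.prod_pow_eq_pow_sum]
  rfl

theorem monomialHom_eq_zero {f : MvPolynomial C ℝ} (hf : f ∈ toricIdeal A) :
    monomialHom A f = 0 := by
  have : toricIdeal A ≤ RingHom.ker (monomialHom A) := by
    refine Ideal.span_le.2 ?_
    rintro _ ⟨u, v, huv, rfl⟩
    rw [SetLike.mem_coe, RingHom.mem_ker, map_sub, monomialHom_monomial, monomialHom_monomial,
      rowExponent_inj.2 huv, sub_self]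
  exact this hf

/-- No monomial of a polynomial in the toric ideal is alone in its fibre. -/
theorem exists_mem_support_of_mem_toricIdeal {f : MvPolynomial C ℝ} (hf : f ∈ toricIdeal A)
    {u : C →₀ ℕ} (hu : u ∈ f.support) : ∃ v ∈ f.support, v ≠ u ∧ A.mulVec v = A.mulVec u := by
  classical
  by_contra! hcon
  have h1 : coeff (rowExponent A u) (monomialHom A f) = coeff u f := by
    conv_lhs => rw [f.as_sum, map_sum]
    simp only [monomialHom_monomial, coeff_sum, coeff_monomial]
    rw [Finset.sum_eq_single_of_mem u hu]
    · simp
    · intro v hv hvu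
      rw [if_neg fun h => hcon v hv hvu (rowExponent_inj.1 h)]
  rw [monomialHom_eq_zero hf, coeff_zero] at h1
  exact mem_support_iff.1 hu h1.symm

/-- The exponent `u` is divisible by the larger exponent of a binomial in `B` with both exponents in
one fibre. -/
def IsReducible (A : Matrix R C ℕ) (m : MonomialOrder C) (B : Set (MvPolynomial C ℝ))
    (u : C →₀ ℕ) : Prop :=
  ∃ a b c : C →₀ ℕ, b ≺[m] a ∧ A.mulVec a = A.mulVec b ∧ u = a + c ∧
    monomial a 1 - monomial b 1 ∈ B

theorem IsReducible.exists_lt {m : MonomialOrder C} {B : Set (MvPolynomial C ℝ)} {u : C →₀ ℕ}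
    (h : IsReducible A m B u) : ∃ v, v ≺[m] u ∧ A.mulVec v = A.mulVec u ∧
      (monomial u 1 - monomial v 1 : MvPolynomial C ℝ) ∈ Ideal.span B := by
  obtain ⟨a, b, c, hlt, hA, rfl, hB⟩ := h
  refine ⟨b + c, ?_, ?_, ?_⟩
  · simpa using hlt
  · simp only [Finsupp.coe_add, Matrix.mulVec_add, hA]
  · have : (monomial (a + c) 1 - monomial (b + c) 1 : MvPolynomial C ℝ) =
        monomial c 1 * (monomial a 1 - monomial b 1) := by
      rw [mul_sub, monomial_mul, monomial_mul, one_mul, add_comm a, add_comm b]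
    rw [this]
    exact Ideal.mul_mem_left _ _ (Ideal.subset_span hB)

/-- Binomials form a Gröbner basis of the toric ideal once every fibre contains at most one
irreducible monomial: that monomial is then the least of its fibre, and every other one reduces
to it. -/
theorem isGroebnerBasis_of_reducible {m : MonomialOrder C} {B : Set (MvPolynomial C ℝ)}
    (hB : B ⊆ toricIdeal A)
    (h : ∀ u v : C →₀ ℕ, u ≠ v → A.mulVec u = A.mulVec v →
      IsReducible A m B u ∨ IsReducible A m B v) :
    IsGroebnerBasis m B (toricIdeal A) := by
  classical
  have hwf : WellFounded fun u v : C →₀ ℕ => u ≺[m] v := InvImage.wf m.toSyn wellFounded_lt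
  constructor
  · refine le_antisymm (Ideal.span_le.2 hB) (Ideal.span_le.2 ?_)
    rintro _ ⟨u, v, huv, rfl⟩
    rw [SetLike.mem_coe]
    induction u using hwf.induction generalizing v with
    | _ u ihu =>
      induction v using hwf.induction with
      | _ v ihv =>
        by_cases hne : u = v
        · rw [hne, sub_self]
          exact Ideal.zero_mem _
        rcases h u v hne huv with hr | hr
        · obtain ⟨u', hlt, hA, hmem⟩ := hr.exists_lt
          have := Ideal.add_mem _ hmem (ihu u' hlt v (hA.trans huv))
          rwa [sub_add_sub_cancel] at this
        · obtain ⟨v', hlt, hA, hmem⟩ := hr.exists_lt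
          have := Ideal.sub_mem _ (ihv v' hlt (huv.trans hA.symm)) hmem
          rwa [sub_sub_sub_cancel_right] at this
  · refine le_antisymm (Ideal.span_mono (Set.image_mono hB)) (Ideal.span_le.2 ?_)
    rintro _ ⟨f, hf, rfl⟩
    rw [SetLike.mem_coe]
    by_cases hf0 : f = 0
    · rw [hf0, m.leadingTerm_zero]
      exact Ideal.zero_mem _
    have hsupp := (m.degree_mem_support_iff f).2 hf0
    obtain ⟨v, hv, hvne, hvA⟩ := exists_mem_support_of_mem_toricIdeal hf hsupp
    have hvlt : v ≺[m] m.degree f :=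
      lt_of_le_of_ne (m.le_degree hv) fun he => hvne (m.toSyn.injective he)
    obtain ⟨w, hwA, hwmin⟩ := hwf.has_min {w | A.mulVec w = A.mulVec (m.degree f)} ⟨_, rfl⟩
    have hwne : m.degree f ≠ w := fun he => hwmin v hvA (he ▸ hvlt)
    have hred : IsReducible A m B (m.degree f) := by
      refine (h _ _ hwne hwA.symm).resolve_right fun hr => ?_
      obtain ⟨w', hlt, hA, -⟩ := hr.exists_lt
      exact hwmin w' (hA.trans hwA) hlt
    obtain ⟨a, b, c, hlt, -, heq, hmem⟩ := hred
    have hlead : m.leadingTerm (monomial a 1 - monomial b 1 : MvPolynomial C ℝ) = monomial a 1 := by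
      have hd : m.degree (monomial b (1 : ℝ)) ≺[m] m.degree (monomial a (1 : ℝ)) := by
        rw [m.degree_monomial, m.degree_monomial]
        simpa using hlt
      rw [MonomialOrder.leadingTerm, m.degree_sub_of_lt hd, m.leadingCoeff_sub_of_lt hd,
        m.degree_monomial, m.leadingCoeff_monomial]
      simp
    have : m.leadingTerm f = monomial c (m.leadingCoeff f) * monomial a 1 := by
      rw [MonomialOrder.leadingTerm, monomial_mul, mul_one, add_comm c, ← heq]
    rw [this, ← hlead]
    exact Ideal.mul_mem_left _ _ (Ideal.subset_span ⟨_, hmem, rfl⟩)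

end Groebner

/-! ### The lexicographic order of the cells -/

section LexCells

variable {V : Type u} [Fintype V] [DecidableEq V] {G : SimpleGraph V}
  {I : V → Type w} [∀ v, Fintype (I v)] [∀ v, DecidableEq (I v)] {pos : V → ℕ}

/-- The number of a level in a fixed enumeration. -/
def level (v : V) (c : I v) : ℕ := Fintype.equivFin (I v) c

theorem level_injective (v : V) : Function.Injective (level (I := I) v) :=
  Fin.val_injective.comp (Fintype.equivFin (I v)).injective

/-- The cell `x` precedes `y` lexicographically on the vertices at positions below `k`. -/
def LexBefore (pos : V → ℕ) (k : ℕ) (x y : State I) : Prop :=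
  ∃ v, pos v < k ∧ (∀ w, pos w < pos v → x w = y w) ∧ level v (x v) < level v (y v)

theorem LexBefore.trans {k : ℕ} {x y z : State I} (hpos : Function.Injective pos)
    (h1 : LexBefore pos k x y) (h2 : LexBefore pos k y z) : LexBefore pos k x z := by
  obtain ⟨v, hv, hv1, hv2⟩ := h1
  obtain ⟨v', hv', hv1', hv2'⟩ := h2
  rcases lt_trichotomy (pos v) (pos v') with hlt | heq | hgt
  · exact ⟨v, hv, fun w hw => (hv1 w hw).trans (hv1' w (hw.trans hlt)), hv1' v hlt ▸ hv2⟩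
  · obtain rfl := hpos heq
    exact ⟨v, hv, fun w hw => (hv1 w hw).trans (hv1' w hw), hv2.trans hv2'⟩
  · exact ⟨v', hv', fun w hw => (hv1 w (hw.trans hgt)).trans (hv1' w hw), (hv1 v' hgt).symm ▸ hv2'⟩

theorem LexBefore.irrefl {k : ℕ} (x : State I) : ¬ LexBefore pos k x x :=
  fun ⟨_, _, _, h⟩ => lt_irrefl _ h

theorem lexBefore_trichotomy (k : ℕ) (x y : State I) :
    (∀ v ∈ before pos k, x v = y v) ∨ LexBefore pos k x y ∨ LexBefore pos k y x := by
  by_cases h : ∀ v ∈ before pos k, x v = y v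
  · exact Or.inl h
  right
  push Not at h
  obtain ⟨v, hv, hmin⟩ := Finset.exists_min_image {v ∈ before pos k | x v ≠ y v} pos
    (by obtain ⟨v, hv, hne⟩ := h; exact ⟨v, by simp [hv, hne]⟩)
  simp only [Finset.mem_filter, mem_before] at hv hmin
  have heq : ∀ w, pos w < pos v → x w = y w := fun w hw => by
    by_contra hne
    exact absurd (hmin w ⟨hw.trans hv.1, hne⟩) (not_le.2 hw)
  rcases lt_or_gt_of_ne ((level_injective v).ne hv.2) with hlt | hgt
  · exact Or.inl ⟨v, hv.1, heq, hlt⟩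
  · exact Or.inr ⟨v, hv.1, fun w hw => (heq w hw).symm, hgt⟩

/-- In the lexicographic monomial order in which smaller cells are larger variables, the least of
four cells decides between two quadratic monomials. -/
theorem exists_monomialOrder (I : V → Type w) [∀ v, Fintype (I v)] [∀ v, DecidableEq (I v)]
    (hpos : Function.Injective pos) :
    ∃ m : MonomialOrder.{max u w, max u w} (State I), ∀ (k : ℕ) (r r' s s' : State I),
      LexBefore pos k r r' → LexBefore pos k r s → LexBefore pos k r s' →
      Finsupp.single s 1 + Finsupp.single s' 1 ≺[m] Finsupp.single r 1 + Finsupp.single r' 1 := by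
  classical
  let _ : LinearOrder V := LinearOrder.lift' pos hpos
  let key : State I → Lex (V → ℕ) := fun x => toLex fun v => level v (x v)
  have hkey : Function.Injective key := fun x y h =>
    funext fun v => level_injective v (congrFun (toLex.injective h) v)
  let _ : LinearOrder (State I) := LinearOrder.lift' key hkey
  have hlt : ∀ k (x y : State I), LexBefore pos k x y → x < y := by
    rintro k x y ⟨v, -, h1, h2⟩
    exact ⟨v, fun w hw => congrArg (level w) (h1 w hw), h2⟩
  refine ⟨MonomialOrder.lex, fun k r r' s s' h1 h2 h3 => ?_⟩
  have h1 := hlt k _ _ h1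
  have h2 := hlt k _ _ h2
  have h3 := hlt k _ _ h3
  rw [MonomialOrder.lex_lt_iff, Finsupp.Lex.lt_iff]
  refine ⟨r, fun j hj => ?_, ?_⟩
  · simp [hj.ne', (hj.trans h1).ne', (hj.trans h2).ne', (hj.trans h3).ne']
  · simp [Finsupp.single_apply, h2.ne', h3.ne']

/-- Marginals for a smaller set of variables are sums of marginals for a larger one; the cells `z`
below list the levels on `E` that extend those of `x` on `D`. -/
theorem marg_eq_sum_marg {M : Type*} [AddCommMonoid M] {D E : Finset V} (hDE : D ⊆ E)
    (p : State I → M) (x : State I) :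
    marg D p x = ∑ z with (∀ v ∈ D, z v = x v) ∧ ∀ v, v ∉ E → z v = x v, marg E p z := by
  unfold marg
  rw [← Finset.sum_fiberwise_of_maps_to (g := fun y => E.piecewise y x)
    (t := {z | (∀ v ∈ D, z v = x v) ∧ ∀ v, v ∉ E → z v = x v})]
  · refine Finset.sum_congr rfl fun z hz => ?_
    simp only [Finset.mem_filter, Finset.mem_univ, true_and] at hz
    congr 1
    ext y
    simp only [Finset.mem_filter, Finset.mem_univ, true_and]
    constructor
    · rintro ⟨-, rfl⟩ v hv
      simp [hv]
    · intro hy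
      refine ⟨fun v hv => (hy v (hDE hv)).trans (hz.1 v hv), funext fun v => ?_⟩
      by_cases hv : v ∈ E
      · simp [hv, hy v hv]
      · simp [hv, hz.2 v hv]
  · intro y hy
    simp only [Finset.mem_filter, Finset.mem_univ, true_and] at hy ⊢
    exact ⟨fun v hv => by simp [hDE hv, hy v hv], fun v hv => by simp [hv]⟩

theorem marg_neg {D : Finset V} (d : State I → ℝ) (x : State I) :
    marg D (fun y => -d y) x = -marg D d x := by
  simp [marg]

/-- Two cells that agree on the earlier neighbours of `v` and that are ordered in the same way by
the vertices before `v` and by the level of `v`. -/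
def IsSortedPair (G : SimpleGraph V) (pos : V → ℕ) (v : V) (r r' : State I) : Prop :=
  (∀ w ∈ parents G pos v, r w = r' w) ∧ LexBefore pos (pos v) r r' ∧
    level v (r v) < level v (r' v)

/-- The exchange step for `marg_sub_sorted`: from an extremal cell `x` where the marginal of `d` is
positive, the row and the column of `x` lead to two negative cells. -/
theorem exists_sortedPair_of_marg_pos {d : State I → ℝ} {v : V} {x : State I}
    (hpos : Function.Injective pos)
    (hrow : marg (before pos (pos v)) d x = 0) (hcol : marg (family G pos v) d x = 0)
    (hx : 0 < marg (before pos (pos v + 1)) d x)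
    (h1 : ∀ y, marg (before pos (pos v + 1)) d y ≠ 0 →
      (∀ w ∈ before pos (pos v), y w = x w) ∨ LexBefore pos (pos v) x y)
    (h2 : ∀ y, marg (before pos (pos v + 1)) d y ≠ 0 → (∀ w ∈ before pos (pos v), y w = x w) →
      level v (y v) ≤ level v (x v)) :
    ∃ r r', IsSortedPair G pos v r r' ∧ d r < 0 ∧ d r' < 0 := by
  have hsub : before pos (pos v) ⊆ before pos (pos v + 1) := by
    rw [before_succ hpos]; exact Finset.subset_insert _ _
  have hfam : family G pos v ⊆ before pos (pos v + 1) := by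
    rw [before_succ hpos]
    exact Finset.insert_subset_insert _ fun w hw => mem_before.2 (mem_parents.1 hw).2
  have hneg : ∀ D ⊆ before pos (pos v + 1), marg D d x = 0 →
      ∃ z, (∀ w ∈ D, z w = x w) ∧ marg (before pos (pos v + 1)) d z < 0 := by
    intro D hD h0
    rw [marg_eq_sum_marg hD] at h0
    by_contra! hcon
    refine absurd h0 (Finset.sum_pos' (fun z hz => ?_) ⟨x, by simp, hx⟩).ne'
    simp only [Finset.mem_filter, Finset.mem_univ, true_and] at hz
    exact hcon z hz.1
  have hcell : ∀ z, marg (before pos (pos v + 1)) d z < 0 →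
      ∃ y, (∀ w ∈ before pos (pos v + 1), y w = z w) ∧ d y < 0 := by
    intro z hz
    by_contra! hcon
    refine absurd hz (not_lt.2 (Finset.sum_nonneg fun y hy => ?_))
    exact hcon y (Finset.mem_filter.1 hy).2
  have hne : ∀ z, marg (before pos (pos v + 1)) d z < 0 →
      (∀ w ∈ before pos (pos v), z w = x w) → z v ≠ x v := by
    intro z hz hzx hv
    rw [marg_congr _ d z x fun w hw => ?_] at hz
    · exact lt_asymm hz hx
    · rw [before_succ hpos, Finset.mem_insert] at hw
      rcases hw with rfl | hw
      · exact hv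
      · exact hzx w hw
  have hmem : ∀ w, pos w < pos v → w ∈ before pos (pos v + 1) :=
    fun w hw => hsub (mem_before.2 hw)
  have hvmem : v ∈ before pos (pos v + 1) := mem_before.2 (Nat.lt_succ_self _)
  obtain ⟨z, hzx, hz⟩ := hneg _ hsub hrow
  obtain ⟨z', hzx', hz'⟩ := hneg _ hfam hcol
  obtain ⟨y, hyz, hy⟩ := hcell z hz
  obtain ⟨y', hyz', hy'⟩ := hcell z' hz'
  have hzlt : level v (z v) < level v (x v) :=
    lt_of_le_of_ne (h2 z hz.ne hzx) ((level_injective v).ne (hne z hz hzx))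
  have hzv' : z' v = x v := hzx' v (Finset.mem_insert_self _ _)
  obtain ⟨v0, hv0, heq0, hlt0⟩ := (h1 z' hz'.ne).resolve_left fun h => hne z' hz' h hzv'
  refine ⟨y, y', ⟨fun w hw => ?_, ⟨v0, hv0, fun w hw => ?_, ?_⟩, ?_⟩, hy, hy'⟩
  · have hwlt := (mem_parents.1 hw).2
    rw [hyz w (hmem w hwlt), hyz' w (hmem w hwlt), hzx w (mem_before.2 hwlt),
      hzx' w (Finset.mem_insert_of_mem hw)]
  · have hwlt := hw.trans hv0
    rw [hyz w (hmem w hwlt), hyz' w (hmem w hwlt), hzx w (mem_before.2 hwlt), heq0 w hw]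
  · rw [hyz v0 (hmem v0 hv0), hyz' v0 (hmem v0 hv0), hzx v0 (mem_before.2 hv0)]
    exact hlt0
  · rw [hyz v hvmem, hyz' v hvmem, hzv']
    exact hzlt

/-- Two different tables in one fibre cannot both be free of sorted pairs. At the first vertex
where their marginals for an initial segment differ, take the least prefix and then the greatest
level at which they do. -/
theorem exists_sortedPair (h : IsPerfectElimination G pos) {d : State I → ℝ} (hd : d ≠ 0)
    (hC : ∀ D : Finset V, G.IsClique (D : Set V) → ∀ x, marg D d x = 0) :
    ∃ v r r', IsSortedPair G pos v r r' ∧ ((d r < 0 ∧ d r' < 0) ∨ (0 < d r ∧ 0 < d r')) := by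
  classical
  have hex : ∃ k, ∃ x, marg (before pos k) d x ≠ 0 := by
    obtain ⟨N, hN⟩ := (Set.finite_range pos).bddAbove
    obtain ⟨x, hx⟩ := Function.ne_iff.1 hd
    refine ⟨N + 1, x, ?_⟩
    rwa [marg_univ fun v => mem_before.2 (Nat.lt_succ_of_le (hN ⟨v, rfl⟩))]
  obtain ⟨k, hk⟩ : ∃ k, Nat.find hex = k := ⟨_, rfl⟩
  have hkex := hk ▸ Nat.find_spec hex
  have hkmin : ∀ j < k, ∀ x, marg (before pos j) d x = 0 := fun j hj x => by
    by_contra hne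
    exact Nat.find_min hex (hk ▸ hj) ⟨x, hne⟩
  obtain ⟨k, rfl⟩ : ∃ j, k = j + 1 := by
    refine ⟨k - 1, (Nat.sub_add_cancel (Nat.one_le_iff_ne_zero.2 ?_)).symm⟩
    rintro rfl
    obtain ⟨x, hx⟩ := hkex
    have : before pos 0 = ∅ := by ext w; simp [mem_before]
    exact hx (this ▸ hC ∅ (by simp) x)
  obtain ⟨v, rfl⟩ : ∃ v, pos v = k := by
    by_contra hcon
    have : before pos (k + 1) = before pos k := by
      ext w
      simp only [mem_before, Nat.lt_succ_iff_lt_or_eq]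
      exact ⟨fun hw => hw.resolve_right fun hw => hcon ⟨w, hw⟩, Or.inl⟩
    obtain ⟨x, hx⟩ := hkex
    exact hx (this ▸ hkmin k (Nat.lt_succ_self k) x)
  have hwf : WellFounded (LexBefore (I := I) pos (pos v)) := by
    have : IsTrans (State I) (LexBefore pos (pos v)) := ⟨fun _ _ _ => LexBefore.trans h.1⟩
    have : Std.Irrefl (LexBefore (I := I) pos (pos v)) := ⟨LexBefore.irrefl⟩
    exact Finite.wellFounded_of_trans_of_irrefl _
  obtain ⟨x0, hx0, hmin⟩ := hwf.has_min {x | marg (before pos (pos v + 1)) d x ≠ 0} hkex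
  obtain ⟨x, hx, hmax⟩ := Finset.exists_max_image
    {x | marg (before pos (pos v + 1)) d x ≠ 0 ∧ ∀ w ∈ before pos (pos v), x w = x0 w}
    (fun x => level v (x v)) ⟨x0, Finset.mem_filter.2 ⟨Finset.mem_univ _, hx0, fun _ _ => rfl⟩⟩
  simp only [Finset.mem_filter, Finset.mem_univ, true_and] at hx hmax
  have h1 : ∀ y, marg (before pos (pos v + 1)) d y ≠ 0 →
      (∀ w ∈ before pos (pos v), y w = x w) ∨ LexBefore pos (pos v) x y := by
    intro y hy
    rcases lexBefore_trichotomy (pos v) y x with h1 | ⟨v0, hv0, heq, hlt⟩ | h1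
    · exact Or.inl h1
    · refine absurd ⟨v0, hv0, fun w hw => ?_, ?_⟩ (hmin y hy)
      · rw [heq w hw, hx.2 w (mem_before.2 (hw.trans hv0))]
      · rwa [← hx.2 v0 (mem_before.2 hv0)]
    · exact Or.inr h1
  have h2 : ∀ y, marg (before pos (pos v + 1)) d y ≠ 0 →
      (∀ w ∈ before pos (pos v), y w = x w) → level v (y v) ≤ level v (x v) :=
    fun y hy hyx => hmax y ⟨hy, fun w hw => (hyx w hw).trans (hx.2 w hw)⟩
  have hrow := hkmin (pos v) (Nat.lt_succ_self _) x
  have hcol := hC _ (h.isClique_family v) x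
  rcases lt_or_gt_of_ne hx.1 with hneg | hgt
  · obtain ⟨r, r', hp, hr, hr'⟩ := exists_sortedPair_of_marg_pos (G := G)
      (d := fun y => -d y) (v := v) (x := x) h.1
      (by rw [marg_neg, hrow, neg_zero]) (by rw [marg_neg, hcol, neg_zero])
      (by rw [marg_neg]; linarith) (fun y hy => h1 y (by simpa [marg_neg] using hy))
      (fun y hy => h2 y (by simpa [marg_neg] using hy))
    exact ⟨v, r, r', hp, Or.inr ⟨by linarith, by linarith⟩⟩
  · obtain ⟨r, r', hp, hr⟩ := exists_sortedPair_of_marg_pos h.1 hrow hcol hgt h1 h2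
    exact ⟨v, r, r', hp, Or.inl hr⟩

theorem mulVec_swap {A B S : Finset V} (hs : SaturatedSeparation G A B S) {r r' : State I}
    (hS : ∀ v ∈ S, r v = r' v) :
    (cliqueMatrix G I).mulVec ⇑(Finsupp.single r 1 + Finsupp.single r' 1 : State I →₀ ℕ) =
      (cliqueMatrix G I).mulVec ⇑(Finsupp.single (A.piecewise r' r) 1 +
        Finsupp.single (A.piecewise r r') 1 : State I →₀ ℕ) := by
  classical
  have hsingle : ∀ (x : State I) (i : CliqueRow G I),
      (cliqueMatrix G I).mulVec ⇑(Finsupp.single x 1) i = cliqueMatrix G I i x := by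
    intro x i
    simp [Matrix.mulVec, dotProduct, Finsupp.single_apply]
  funext ⟨C, c⟩
  simp only [Finsupp.coe_add, Matrix.mulVec_add, Pi.add_apply, hsingle]
  have hrow : ∀ x y : State I, (∀ v ∈ C.1, x v = y v) →
      cliqueMatrix G I ⟨C, c⟩ x = cliqueMatrix G I ⟨C, c⟩ y := by
    intro x y hxy
    have : (∀ v : {v // v ∈ C.1}, x v = c v) ↔ ∀ v : {v // v ∈ C.1}, y v = c v :=
      forall_congr' fun v => by rw [hxy v v.2]
    simp only [cliqueMatrix, this]
  rcases hs.clique_swap hS C.2.1 with ⟨h1, h2⟩ | ⟨h1, h2⟩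
  · rw [hrow _ _ h1, hrow _ _ h2]
  · rw [hrow _ _ h1, hrow _ _ h2, add_comm]

theorem X_mul_X_eq_monomial (r r' : State I) :
    (X r * X r' : MvPolynomial (State I) ℝ) =
      monomial (Finsupp.single r 1 + Finsupp.single r' 1) 1 := by
  rw [X, X, monomial_mul, one_mul]

theorem globalBinomials_subset_toricIdeal :
    globalBinomials G I ⊆ toricIdeal (cliqueMatrix G I) := by
  rintro _ ⟨A, B, S, hs, x, x', y, y', z, -, -, rfl⟩
  refine Ideal.subset_span ⟨_, _, mulVec_swap hs (r := cell A B x y z) (r' := cell A B x' y' z)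
    fun v hv => ?_, ?_⟩
  · have h1 : v ∉ A := fun hA => Finset.disjoint_left.1 hs.2.1 hA hv
    have h2 : v ∉ B := fun hB => Finset.disjoint_left.1 hs.2.2.1 hB hv
    simp [cell, h1, h2]
  · rw [cpd_eq_swap, X_mul_X_eq_monomial, X_mul_X_eq_monomial]

/-- Every sorted pair of cells is the leading term of a binomial of a separation statement. -/
theorem exists_groebnerBasis_of_perfectElimination (h : IsPerfectElimination G pos) :
    ∃ m : MonomialOrder.{max u w, max u w} (State I),
      IsGroebnerBasis m (globalBinomials G I) (toricIdeal (cliqueMatrix G I)) := by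
  classical
  obtain ⟨m, hm⟩ := exists_monomialOrder I h.1
  refine ⟨m, isGroebnerBasis_of_reducible globalBinomials_subset_toricIdeal
    fun a b hne hab => ?_⟩
  have hred : ∀ (u : State I →₀ ℕ) v r r', IsSortedPair G pos v r r' → 0 < u r → 0 < u r' →
      IsReducible (cliqueMatrix G I) m (globalBinomials G I) u := by
    rintro u v r r' ⟨hpar, ⟨v0, hv0, heq0, hlt0⟩, hlev⟩ hr hr'
    obtain ⟨A, B, hs, hvA, hA, hB⟩ := h.exists_separation v
    have hv0B : v0 ∈ B := hB v0 hv0 fun hp => hlt0.ne (congrArg _ (hpar v0 hp))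
    have hrne : r ≠ r' := fun he => hlev.ne (by rw [he])
    have hle : Finsupp.single r 1 + Finsupp.single r' 1 ≤ u := by
      intro x
      rcases eq_or_ne r x with rfl | h1
      · simp [hrne.symm]; omega
      · rcases eq_or_ne r' x with rfl | h2
        · simp [h1]; omega
        · simp [h1, h2]
    obtain ⟨c, hc⟩ := exists_add_of_le hle
    refine ⟨_, _, c, hm (pos v + 1) r r' (A.piecewise r' r) (A.piecewise r r')
      ⟨v0, hv0.trans (Nat.lt_succ_self _), heq0, hlt0⟩ ⟨v, Nat.lt_succ_self _, fun w hw => ?_, ?_⟩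
      ⟨v0, hv0.trans (Nat.lt_succ_self _), fun w hw => ?_, ?_⟩, mulVec_swap hs hpar, hc, ?_⟩
    · simp [hA w hw]
    · simpa [hvA] using hlev
    · simp [hA w (hw.trans hv0), heq0 w hw]
    · simpa [hA v0 hv0] using hlt0
    · rw [← X_mul_X_eq_monomial, ← X_mul_X_eq_monomial]
      exact swap_mem_globalBinomials hs hpar ⟨v, hvA, fun he => hlev.ne (by rw [he])⟩
        ⟨v0, hv0B, fun he => hlt0.ne (by rw [he])⟩
  obtain ⟨v, r, r', hp, hsgn⟩ := exists_sortedPair (d := fun x => (a x : ℝ) - b x) h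
    (fun he => hne (Finsupp.ext fun x => by
      have := congrFun he x
      simpa [sub_eq_zero] using this))
    (fun D hD x => marg_eq_zero_of_clique (G := G) (fun i => by
      have := congrArg (Nat.cast (R := ℝ)) (congrFun hab i)
      simp only [Matrix.mulVec, dotProduct, Nat.cast_sum, Nat.cast_mul] at this
      simp only [mul_sub, Finset.sum_sub_distrib, this, sub_self]) hD x)
  rcases hsgn with ⟨h1, h2⟩ | ⟨h1, h2⟩
  · right
    refine hred b v r r' hp ?_ ?_
    · have : (0 : ℝ) < b r := by have := Nat.cast_nonneg (α := ℝ) (a r); linarith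
      exact_mod_cast this
    · have : (0 : ℝ) < b r' := by have := Nat.cast_nonneg (α := ℝ) (a r'); linarith
      exact_mod_cast this
  · left
    refine hred a v r r' hp ?_ ?_
    · have : (0 : ℝ) < a r := by have := Nat.cast_nonneg (α := ℝ) (b r); linarith
      exact_mod_cast this
    · have : (0 : ℝ) < a r' := by have := Nat.cast_nonneg (α := ℝ) (b r'); linarith
      exact_mod_cast this

end LexCells

end

/-! ### Chordless cycles and perfect elimination -/

section

open SimpleGraph

section Graph

variable {V : Type u} {G : SimpleGraph V}

/-- Connectedness of the subgraph induced on `A`, in the form of a closure property: a set that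
contains a vertex of `A` and is closed under adjacency inside `A` contains `A`. -/
def ConnectedOn (G : SimpleGraph V) (A : Set V) : Prop :=
  ∀ X : Set V, (∀ u ∈ A, ∀ w ∈ A, G.Adj u w → u ∈ X → w ∈ X) → ∀ u ∈ A, ∀ w ∈ A, u ∈ X → w ∈ X

/-- A cycle through `a, y, b` whose remaining part is replaced by a connected set `A`: the vertices
`a`, `b` are not adjacent, both are adjacent to `y` and to `A`, and no vertex of `A` is adjacent
to `y`. Such configurations exist exactly when the graph has a chordless cycle of length at least
four. -/
structure IsHole (G : SimpleGraph V) (y a b : V) (A : Set V) : Prop where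
  ne : a ≠ b
  not_adj : ¬ G.Adj a b
  adj_left : G.Adj y a
  adj_right : G.Adj y b
  apex_notMem : y ∉ A
  left_notMem : a ∉ A
  right_notMem : b ∉ A
  apex_not_adj : ∀ w ∈ A, ¬ G.Adj y w
  connected : ConnectedOn G A
  exists_left : ∃ w ∈ A, G.Adj a w
  exists_right : ∃ w ∈ A, G.Adj b w

theorem exists_isHole_of_not_isDecomposable (h : ¬ IsDecomposable G) :
    ∃ y a b A, IsHole G y a b A := by
  unfold IsDecomposable at h
  push Not at h
  obtain ⟨v, c, hc, hlen, hch⟩ := h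
  set n := c.length with hn
  set g := c.getVert with hg
  have hg0 : g 0 = v := c.getVert_zero
  have hgn : g n = v := c.getVert_length
  have hinj : ∀ i j, i < n → j < n → g i = g j → i = j := fun i j hi hj hij =>
    hc.getVert_injOn' (show i ≤ c.length - 1 by omega) (show j ≤ c.length - 1 by omega) hij
  have hmem : ∀ i, g i ∈ c.support := fun i => c.getVert_mem_support i
  have hadj : ∀ i, i < n → G.Adj (g i) (g (i + 1)) := fun i hi => c.adj_getVert_succ hi
  have key : ∀ i j, i < j → j < n → G.Adj (g i) (g j) → j = i + 1 ∨ (i = 0 ∧ j = n - 1) := by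
    intro i j hij hj hA
    have := hch _ (hmem i) _ (hmem j) hA
    obtain ⟨k, hk, he⟩ := (c.mk_mem_edges_iff_exists).1 this
    rw [Sym2.eq_iff] at he
    rcases Nat.lt_or_ge (k + 1) n with hk1 | hk1
    · rcases he with ⟨h1, h2⟩ | ⟨h1, h2⟩
      · have := hinj k i (by omega) (by omega) h1
        have := hinj (k + 1) j (by omega) (by omega) h2
        omega
      · have := hinj k j (by omega) (by omega) h1
        have := hinj (k + 1) i (by omega) (by omega) h2
        omega
    · have hkn : k + 1 = n := by omega
      have h0 : c.getVert (k + 1) = g 0 := by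
        rw [hkn]
        exact hgn.trans hg0.symm
      rw [h0] at he
      rcases he with ⟨h1, h2⟩ | ⟨h1, h2⟩
      · have := hinj k i (by omega) (by omega) h1
        have := hinj 0 j (by omega) (by omega) h2
        omega
      · have := hinj k j (by omega) (by omega) h1
        have := hinj 0 i (by omega) (by omega) h2
        omega
  refine ⟨g 0, g 1, g (n - 1), {x | ∃ i, 2 ≤ i ∧ i ≤ n - 2 ∧ x = g i}, ?_, ?_, ?_, ?_, ?_, ?_, ?_,
    ?_, ?_, ?_, ?_⟩
  · intro he
    have := hinj 1 (n - 1) (by omega) (by omega) he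
    omega
  · intro hA
    have := key 1 (n - 1) (by omega) (by omega) hA
    omega
  · exact hadj 0 (by omega)
  · have := hadj (n - 1) (by omega)
    rw [Nat.sub_add_cancel (by omega), hgn, ← hg0] at this
    exact this.symm
  · rintro ⟨i, h1, h2, he⟩
    have := hinj 0 i (by omega) (by omega) he
    omega
  · rintro ⟨i, h1, h2, he⟩
    have := hinj 1 i (by omega) (by omega) he
    omega
  · rintro ⟨i, h1, h2, he⟩
    have := hinj (n - 1) i (by omega) (by omega) he
    omega
  · rintro _ ⟨i, h1, h2, rfl⟩ hA
    have := key 0 i (by omega) (by omega) hA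
    omega
  · have hstep : ∀ X : Set V, (∀ u ∈ {x | ∃ i, 2 ≤ i ∧ i ≤ n - 2 ∧ x = g i},
        ∀ w ∈ {x | ∃ i, 2 ≤ i ∧ i ≤ n - 2 ∧ x = g i}, G.Adj u w → u ∈ X → w ∈ X) →
        ∀ i, 2 ≤ i → i ≤ n - 2 → (g i ∈ X ↔ g 2 ∈ X) := by
      intro X hX i hi
      induction i, hi using Nat.le_induction with
      | base => exact fun _ => Iff.rfl
      | succ i hi ih =>
        intro hin
        rw [← ih (by omega)]
        have h1 : ∃ j, 2 ≤ j ∧ j ≤ n - 2 ∧ g i = g j := ⟨i, hi, by omega, rfl⟩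
        have h2 : ∃ j, 2 ≤ j ∧ j ≤ n - 2 ∧ g (i + 1) = g j := ⟨i + 1, by omega, hin, rfl⟩
        exact ⟨hX _ h2 _ h1 (hadj i (by omega)).symm, hX _ h1 _ h2 (hadj i (by omega))⟩
    rintro X hX _ ⟨i, hi, hi', rfl⟩ _ ⟨j, hj, hj', rfl⟩ hmemX
    rw [hstep X hX j hj hj', ← hstep X hX i hi hi']
    exact hmemX
  · exact ⟨g 2, ⟨2, le_rfl, by omega, rfl⟩, hadj 1 (by omega)⟩
  · refine ⟨g (n - 2), ⟨n - 2, by omega, le_rfl, rfl⟩, ?_⟩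
    have := hadj (n - 2) (by omega)
    rw [show n - 2 + 1 = n - 1 by omega] at this
    exact this.symm

/-- A walk of minimal length among those inside `T` has no chords. -/
theorem mem_edges_of_minimal {T : Set V} {a b : V} {q : G.Walk a b} (hq : ∀ z ∈ q.support, z ∈ T)
    (hmin : ∀ p : G.Walk a b, (∀ z ∈ p.support, z ∈ T) → q.length ≤ p.length) {u w : V}
    (hu : u ∈ q.support) (hw : w ∈ q.support) (hadj : G.Adj u w) : s(u, w) ∈ q.edges := by
  have key : ∀ i j, i < j → j ≤ q.length → G.Adj (q.getVert i) (q.getVert j) →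
      s(q.getVert i, q.getVert j) ∈ q.edges := by
    intro i j hij hj hA
    have := hmin ((q.take i).append (Walk.cons hA (q.drop j))) fun z hz => by
      rw [Walk.mem_support_append_iff, Walk.support_cons, List.mem_cons] at hz
      apply hq
      rcases hz with hz | rfl | hz
      · rw [Walk.support_take] at hz
        exact List.mem_of_mem_take hz
      · exact q.getVert_mem_support i
      · obtain ⟨m, hm, -⟩ := Walk.mem_support_iff_exists_getVert.1 hz
        rw [← hm, Walk.drop_getVert]
        exact q.getVert_mem_support _
    rw [Walk.length_append, Walk.length_cons, Walk.take_length, Walk.drop_length] at this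
    obtain rfl : j = i + 1 := by omega
    exact q.mk_mem_edges_iff_exists.2 ⟨i, by omega, rfl⟩
  obtain ⟨i, rfl, hi⟩ := Walk.mem_support_iff_exists_getVert.1 hu
  obtain ⟨j, rfl, hj⟩ := Walk.mem_support_iff_exists_getVert.1 hw
  rcases lt_trichotomy i j with hij | rfl | hij
  · exact key i j hij hj hadj
  · exact absurd rfl hadj.ne
  · rw [Sym2.eq_swap]
    exact key j i hij hi hadj.symm

/-- Closing a shortest path from `a` to `b` through `A` by the vertex `y` gives a chordless
cycle. -/
theorem IsHole.not_isDecomposable [DecidableEq V] {y a b : V} {A : Set V}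
    (h : IsHole G y a b A) : ¬ IsDecomposable G := by
  classical
  set T : Set V := insert a (insert b A) with hT
  have hex : ∃ n, ∃ p : G.Walk a b, (∀ z ∈ p.support, z ∈ T) ∧ p.length = n := by
    obtain ⟨a', ha', haa'⟩ := h.exists_left
    obtain ⟨b', hb', hbb'⟩ := h.exists_right
    have := h.connected {w | ∃ p : G.Walk a w, ∀ z ∈ p.support, z ∈ T} (by
      rintro u - w hw huw ⟨p, hp⟩
      refine ⟨p.concat huw, fun z hz => ?_⟩
      rw [Walk.support_concat, List.mem_append, List.mem_singleton] at hz
      rcases hz with hz | rfl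
      · exact hp z hz
      · simp [hT, hw]) a' ha' b' hb' ⟨Walk.cons haa' .nil, by simp [hT, ha']⟩
    obtain ⟨p, hp⟩ := this
    refine ⟨_, p.concat hbb'.symm, fun z hz => ?_, rfl⟩
    rw [Walk.support_concat, List.mem_append, List.mem_singleton] at hz
    rcases hz with hz | rfl
    · exact hp z hz
    · simp [hT]
  obtain ⟨p, hp, hpn⟩ := Nat.find_spec hex
  have hpmin : ∀ q : G.Walk a b, (∀ z ∈ q.support, z ∈ T) → p.length ≤ q.length :=
    fun q hq => hpn ▸ Nat.find_min' hex ⟨q, hq, rfl⟩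
  set q := p.bypass with hqdef
  have hqT : ∀ z ∈ q.support, z ∈ T := fun z hz => hp z (p.support_bypass_subset_support hz)
  have hqmin : ∀ r : G.Walk a b, (∀ z ∈ r.support, z ∈ T) → q.length ≤ r.length :=
    fun r hr => p.length_bypass_le_length.trans (hpmin r hr)
  have hqpath : q.IsPath := p.bypass_isPath
  have hyT : y ∉ T := by
    simp only [hT, Set.mem_insert_iff, not_or]
    exact ⟨h.adj_left.ne, h.adj_right.ne, h.apex_notMem⟩
  have hyq : y ∉ q.support := fun hy => hyT (hqT y hy)
  have hlen : 2 ≤ q.length := by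
    by_contra! hlt
    rcases Nat.lt_or_ge q.length 1 with h0 | h1
    · exact h.ne (Walk.eq_of_length_eq_zero (p := q) (by omega))
    · exact h.not_adj (Walk.adj_of_length_eq_one (p := q) (by omega))
  intro hdec
  have hcyc : (Walk.cons h.adj_left (q.concat h.adj_right.symm)).IsCycle := by
    rw [Walk.cons_isCycle_iff, Walk.concat_isPath_iff]
    refine ⟨⟨hqpath, hyq⟩, fun he => ?_⟩
    rw [Walk.edges_concat, List.concat_eq_append, List.mem_append, List.mem_singleton] at he
    rcases he with he | he
    · exact hyq (Walk.fst_mem_support_of_mem_edges _ he)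
    · rw [Sym2.eq_iff] at he
      rcases he with ⟨h1, -⟩ | ⟨-, h1⟩
      · exact h.adj_right.ne h1
      · exact h.ne h1
  obtain ⟨u, hu, w, hw, huw, hne⟩ := hdec y _ hcyc (by
    rw [Walk.length_cons, Walk.length_concat]; omega)
  rw [Walk.edges_cons, Walk.edges_concat, List.concat_eq_append, List.mem_cons, List.mem_append,
    List.mem_singleton, not_or, not_or] at hne
  have hsupp : ∀ z, z ∈ (Walk.cons h.adj_left (q.concat h.adj_right.symm)).support →
      z = y ∨ z ∈ q.support := by
    intro z hz
    rw [Walk.support_cons, Walk.support_concat, List.mem_cons, List.mem_append,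
      List.mem_singleton] at hz
    tauto
  have hyadj : ∀ z ∈ q.support, G.Adj y z → z = a ∨ z = b := by
    intro z hz hyz
    have := hqT z hz
    simp only [hT, Set.mem_insert_iff] at this
    rcases this with h1 | h1 | h1
    · exact Or.inl h1
    · exact Or.inr h1
    · exact absurd hyz (h.apex_not_adj z h1)
  have hyne : ∀ z ∈ q.support, G.Adj y z → s(y, z) = s(y, a) ∨ s(y, z) = s(b, y) := by
    intro z hz hyz
    rcases hyadj z hz hyz with rfl | rfl
    · exact Or.inl rfl
    · exact Or.inr Sym2.eq_swap
  rcases hsupp u hu with rfl | hu' <;> rcases hsupp w hw with rfl | hw'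
  · exact huw.ne rfl
  · rcases hyne w hw' huw with he | he
    · exact hne.1 he
    · exact hne.2.2 he
  · rw [Sym2.eq_swap] at hne
    rcases hyne u hu' huw.symm with he | he
    · exact hne.1 he
    · exact hne.2.2 he
  · exact hne.2.1 (mem_edges_of_minimal hqT hqmin hu' hw' huw)

/-- The neighbours of `v` in `W` are pairwise adjacent. -/
def IsSimplicialIn (G : SimpleGraph V) (W : Finset V) (v : V) : Prop :=
  ∀ a ∈ W, ∀ b ∈ W, G.Adj v a → G.Adj v b → a ≠ b → G.Adj a b

/-- Dirac's lemma: without holes, a vertex `y` of `W` that is not adjacent to all of `W` has a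
simplicial non-neighbour. One looks for it in a component `A` of the non-neighbours of `y`; the
boundary of `A` consists of neighbours of `y` and is a clique, or else `y` and `A` would form a
hole. -/
theorem exists_simplicial [DecidableEq V] (hG : ∀ y a b A, ¬ IsHole G y a b A) (W : Finset V) :
    ∀ y ∈ W, (∃ x ∈ W, x ≠ y ∧ ¬ G.Adj y x) →
      ∃ v ∈ W, v ≠ y ∧ ¬ G.Adj y v ∧ IsSimplicialIn G W v := by
  classical
  induction W using Finset.strongInduction with
  | _ W ih =>
    rintro y hy ⟨x, hx, hxy, hnadj⟩
    let N : Set V := {w | w ∈ W ∧ w ≠ y ∧ ¬ G.Adj y w}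
    let R : V → V → Prop := fun p q => G.Adj p q ∧ q ∈ N
    let A : Finset V := {w ∈ W | Relation.ReflTransGen R x w}
    have hAmem : ∀ w, Relation.ReflTransGen R x w → w ∈ N := by
      intro w hw
      induction hw with
      | refl => exact ⟨hx, hxy, hnadj⟩
      | tail _ hbc _ => exact hbc.2
    have hA : ∀ w, w ∈ A ↔ Relation.ReflTransGen R x w := by
      intro w
      simp only [A, Finset.mem_filter, and_iff_right_iff_imp]
      exact fun hw => (hAmem w hw).1
    have hAN : ∀ w ∈ A, w ∈ N := fun w hw => hAmem w ((hA w).1 hw)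
    have hxA : x ∈ A := (hA x).2 .refl
    let S : Finset V := {s ∈ W | s ∉ A ∧ ∃ w ∈ A, G.Adj w s}
    have hSmem : ∀ s, s ∈ S ↔ s ∈ W ∧ s ∉ A ∧ ∃ w ∈ A, G.Adj w s := fun s => by simp [S]
    have hSy : ∀ s ∈ S, G.Adj y s := by
      intro s hs
      obtain ⟨hsW, hsA, w, hw, hws⟩ := (hSmem s).1 hs
      by_contra hys
      refine hsA ((hA s).2 (((hA w).1 hw).tail ⟨hws, hsW, ?_, hys⟩))
      rintro rfl
      exact (hAN w hw).2.2 hws.symm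
    have hconn : ConnectedOn G (A : Set V) := by
      intro X hX
      have : ∀ w, Relation.ReflTransGen R x w → (w ∈ X ↔ x ∈ X) := by
        intro w hw
        induction hw with
        | refl => exact Iff.rfl
        | @tail b c hb hbc ih' =>
          rw [← ih']
          have hb' := (hA b).2 hb
          have hc' := (hA c).2 (hb.tail hbc)
          exact ⟨hX c hc' b hb' hbc.1.symm, hX b hb' c hc' hbc.1⟩
      intro u hu w hw huX
      rw [this w ((hA w).1 hw), ← this u ((hA u).1 hu)]
      exact huX
    have hS : ∀ a ∈ S, ∀ b ∈ S, a ≠ b → G.Adj a b := by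
      intro a ha b hb hab
      by_contra hnab
      obtain ⟨-, haA, wa, hwa, hwaa⟩ := (hSmem a).1 ha
      obtain ⟨-, hbA, wb, hwb, hwbb⟩ := (hSmem b).1 hb
      exact hG y a b A ⟨hab, hnab, hSy a ha, hSy b hb, fun hyA => (hAN y hyA).2.1 rfl, haA, hbA,
        fun w hw => (hAN w hw).2.2, hconn, ⟨wa, hwa, hwaa.symm⟩, ⟨wb, hwb, hwbb.symm⟩⟩
    have hss : A ∪ S ⊂ W := by
      refine Finset.ssubset_iff_subset_ne.2 ⟨fun w hw => ?_, fun he => ?_⟩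
      · rcases Finset.mem_union.1 hw with hw | hw
        · exact (hAN w hw).1
        · exact ((hSmem w).1 hw).1
      · rw [← he, Finset.mem_union] at hy
        rcases hy with hy | hy
        · exact (hAN y hy).2.1 rfl
        · exact (hSy y hy).ne rfl
    obtain ⟨v, hvA, hv⟩ : ∃ v ∈ A, IsSimplicialIn G (A ∪ S) v := by
      by_cases h1 : ∃ s ∈ S, ∃ z ∈ A ∪ S, z ≠ s ∧ ¬ G.Adj s z
      · obtain ⟨s, hs, hz⟩ := h1
        obtain ⟨v, hv, hvs, hsv, hsim⟩ := ih _ hss s (Finset.mem_union_right _ hs) hz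
        refine ⟨v, (Finset.mem_union.1 hv).resolve_right fun hvS => ?_, hsim⟩
        exact hsv (hS s hs v hvS hvs.symm)
      · by_cases h2 : ∃ s ∈ A, ∃ z ∈ A ∪ S, z ≠ s ∧ ¬ G.Adj s z
        · obtain ⟨s, hs, hz⟩ := h2
          obtain ⟨v, hv, hvs, hsv, hsim⟩ := ih _ hss s (Finset.mem_union_left _ hs) hz
          refine ⟨v, (Finset.mem_union.1 hv).resolve_right fun hvS => ?_, hsim⟩
          exact h1 ⟨v, hvS, s, Finset.mem_union_left _ hs, hvs.symm, fun hadj => hsv hadj.symm⟩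
        · refine ⟨x, hxA, fun a ha b hb _ _ hab => ?_⟩
          by_contra hnab
          rcases Finset.mem_union.1 ha with ha | ha
          · exact h2 ⟨a, ha, b, hb, hab.symm, hnab⟩
          · exact h1 ⟨a, ha, b, hb, hab.symm, hnab⟩
    refine ⟨v, (hAN v hvA).1, (hAN v hvA).2.1, (hAN v hvA).2.2, fun a ha b hb hva hvb hab => ?_⟩
    have hAS : ∀ z ∈ W, G.Adj v z → z ∈ A ∪ S := by
      intro z hz hvz
      by_cases hzA : z ∈ A
      · exact Finset.mem_union_left _ hzA
      · exact Finset.mem_union_right _ ((hSmem z).2 ⟨hz, hzA, v, hvA, hvz⟩)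
    exact hv a (hAS a ha hva) b (hAS b hb hvb) hva hvb hab

/-- Placing simplicial vertices last yields a perfect elimination ordering. -/
theorem exists_perfectElimination [Fintype V] [DecidableEq V]
    (hG : ∀ y a b A, ¬ IsHole G y a b A) : ∃ pos : V → ℕ, IsPerfectElimination G pos := by
  classical
  have key : ∀ (n : ℕ) (W : Finset V), W.card = n → ∃ pos : V → ℕ, (∀ v ∈ W, pos v < n) ∧
      (∀ v ∈ W, ∀ w ∈ W, pos v = pos w → v = w) ∧ ∀ v ∈ W, ∀ a ∈ W, ∀ b ∈ W, G.Adj v a →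
        G.Adj v b → pos a < pos v → pos b < pos v → a ≠ b → G.Adj a b := by
    intro n
    induction n with
    | zero =>
      intro W hW
      rw [Finset.card_eq_zero] at hW
      subst hW
      exact ⟨fun _ => 0, by simp, by simp, by simp⟩
    | succ n ih =>
      intro W hW
      obtain ⟨v, hv, hsim⟩ : ∃ v ∈ W, IsSimplicialIn G W v := by
        by_cases h : ∃ y ∈ W, ∃ x ∈ W, x ≠ y ∧ ¬ G.Adj y x
        · obtain ⟨y, hy, hx⟩ := h
          obtain ⟨v, hv, -, -, hsim⟩ := exists_simplicial hG W y hy hx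
          exact ⟨v, hv, hsim⟩
        · obtain ⟨v, hv⟩ := Finset.card_pos.1 (by omega : 0 < W.card)
          refine ⟨v, hv, fun a ha b hb _ _ hab => ?_⟩
          by_contra hnab
          exact h ⟨a, ha, b, hb, hab.symm, hnab⟩
      obtain ⟨pos, h1, h2, h3⟩ := ih (W.erase v) (by rw [Finset.card_erase_of_mem hv, hW]; rfl)
      have hval : ∀ w ∈ W, w ≠ v → Function.update pos v n w = pos w ∧ pos w < n :=
        fun w hw hwv => ⟨Function.update_of_ne hwv _ _, h1 w (Finset.mem_erase.2 ⟨hwv, hw⟩)⟩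
      have hself : Function.update pos v n v = n := Function.update_self _ _ _
      refine ⟨Function.update pos v n, fun w hw => ?_, fun w hw z hz hwz => ?_,
        fun w hw a ha b hb hwa hwb hla hlb hab => ?_⟩
      · by_cases hwv : w = v
        · rw [hwv, hself]; omega
        · have := hval w hw hwv; omega
      · by_cases hwv : w = v <;> by_cases hzv : z = v
        · rw [hwv, hzv]
        · have := hval z hz hzv
          rw [hwv, hself] at hwz; omega
        · have := hval w hw hwv
          rw [hzv, hself] at hwz; omega
        · rw [(hval w hw hwv).1, (hval z hz hzv).1] at hwz
          exact h2 w (Finset.mem_erase.2 ⟨hwv, hw⟩) z (Finset.mem_erase.2 ⟨hzv, hz⟩) hwz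
      · by_cases hwv : w = v
        · subst hwv
          exact hsim a ha b hb hwa hwb hab
        · have hw' := hval w hw hwv
          have hav : a ≠ v := by
            rintro rfl
            rw [hself] at hla; omega
          have hbv : b ≠ v := by
            rintro rfl
            rw [hself] at hlb; omega
          rw [(hval a ha hav).1, hw'.1] at hla
          rw [(hval b hb hbv).1, hw'.1] at hlb
          exact h3 w (Finset.mem_erase.2 ⟨hwv, hw⟩) a (Finset.mem_erase.2 ⟨hav, ha⟩) b
            (Finset.mem_erase.2 ⟨hbv, hb⟩) hwa hwb hla hlb hab
  obtain ⟨pos, -, h2, h3⟩ := key _ Finset.univ rfl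
  exact ⟨pos, fun v w h => h2 v (Finset.mem_univ v) w (Finset.mem_univ w) h,
    fun v a b => h3 v (Finset.mem_univ v) a (Finset.mem_univ a) b (Finset.mem_univ b)⟩

theorem IsDecomposable.exists_perfectElimination [Fintype V] [DecidableEq V]
    (h : IsDecomposable G) : ∃ pos : V → ℕ, IsPerfectElimination G pos :=
  DiscreteModel.exists_perfectElimination fun _ _ _ _ hh => hh.not_isDecomposable h

end Graph

end

/-! ### Four-cycle minors and the tables that live on them -/

section

open MvPolynomial Filter Topology

section Minor

variable {V : Type u} {G : SimpleGraph V}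

/-- A four-cycle as an induced minor: four disjoint connected blocks of vertices, consecutive blocks
joined by an edge and opposite blocks not joined. The value `none` marks the vertices outside the
blocks. -/
structure IsFourCycleMinor (G : SimpleGraph V) (blk : V → Option (Fin 4)) : Prop where
  opposite : ∀ u w i, blk u = some i → blk w = some (i + 2) → ¬ G.Adj u w
  consecutive : ∀ i, ∃ u w, blk u = some i ∧ blk w = some (i + 1) ∧ G.Adj u w
  connected : ∀ i, ConnectedOn G {v | blk v = some i}

theorem connectedOn_of_subsingleton {A : Set V} (h : A.Subsingleton) : ConnectedOn G A :=
  fun _ _ _ hu _ hw huX => h hu hw ▸ huX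

theorem IsHole.exists_isFourCycleMinor {y a b : V} {A : Set V} (h : IsHole G y a b A) :
    ∃ blk, IsFourCycleMinor G blk := by
  classical
  let blk : V → Option (Fin 4) := fun v =>
    if v = y then some 0 else if v = a then some 1 else if v ∈ A then some 2
    else if v = b then some 3 else none
  have hay := h.adj_left.ne'
  have hby := h.adj_right.ne'
  have h0 : ∀ v, blk v = some 0 ↔ v = y := by
    intro v
    simp only [blk]
    split_ifs <;> simp_all
  have h1 : ∀ v, blk v = some 1 ↔ v = a := by
    intro v
    simp only [blk]
    split_ifs with h1 h2 h3 h4 <;> simp_all [eq_comm]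
  have h2 : ∀ v, blk v = some 2 ↔ v ∈ A := by
    intro v
    simp only [blk]
    split_ifs with h1 h2 h3 h4 <;> simp_all [h.apex_notMem, h.left_notMem]
  have h3 : ∀ v, blk v = some 3 ↔ v = b := by
    intro v
    simp only [blk]
    split_ifs with h1 h2 h3 h4
    · simp [h1, hby.symm]
    · simp [h2, h.ne]
    · simp only [Option.some.injEq, Fin.reduceEq, false_iff]
      rintro rfl
      exact h.right_notMem h3
    · simp [h4]
    · simp [h4]
  refine ⟨blk, ⟨fun u w i hu hw => ?_, fun i => ?_, fun i => ?_⟩⟩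
  · fin_cases i
    · have hu := (h0 u).1 hu
      have hw := (h2 w).1 hw
      exact hu ▸ h.apex_not_adj w hw
    · have hu := (h1 u).1 hu
      have hw := (h3 w).1 hw
      exact hu ▸ hw ▸ h.not_adj
    · have hu := (h2 u).1 hu
      have hw := (h0 w).1 hw
      exact fun hadj => h.apex_not_adj u hu (hw ▸ hadj.symm)
    · have hu := (h3 u).1 hu
      have hw := (h1 w).1 hw
      exact fun hadj => h.not_adj (hu ▸ hw ▸ hadj.symm)
  · obtain ⟨a', ha', haa'⟩ := h.exists_left
    obtain ⟨b', hb', hbb'⟩ := h.exists_right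
    fin_cases i
    · exact ⟨y, a, (h0 y).2 rfl, (h1 a).2 rfl, h.adj_left⟩
    · exact ⟨a, a', (h1 a).2 rfl, (h2 a').2 ha', haa'⟩
    · exact ⟨b', b, (h2 b').2 hb', (h3 b).2 rfl, hbb'.symm⟩
    · exact ⟨b, y, (h3 b).2 rfl, (h0 y).2 rfl, h.adj_right.symm⟩
  · fin_cases i
    · exact connectedOn_of_subsingleton fun u hu w hw => ((h0 u).1 hu).trans ((h0 w).1 hw).symm
    · exact connectedOn_of_subsingleton fun u hu w hw => ((h1 u).1 hu).trans ((h1 w).1 hw).symm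
    · have : {v | blk v = some 2} = A := Set.ext h2
      exact this.symm ▸ h.connected
    · exact connectedOn_of_subsingleton fun u hu w hw => ((h3 u).1 hu).trans ((h3 w).1 hw).symm

theorem exists_isFourCycleMinor_of_not_isDecomposable (h : ¬ IsDecomposable G) :
    ∃ blk, IsFourCycleMinor G blk := by
  obtain ⟨y, a, b, A, hh⟩ := exists_isHole_of_not_isDecomposable h
  exact hh.exists_isFourCycleMinor

/-- A clique meets at most two blocks, and these are consecutive. -/
theorem IsFourCycleMinor.clique_blocks {blk : V → Option (Fin 4)} (h : IsFourCycleMinor G blk)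
    {C : Finset V} (hC : G.IsClique (C : Set V)) :
    ∃ i : Fin 4, ∀ v ∈ C, ∀ j, blk v = some j → j = i ∨ j = i + 1 := by
  classical
  have comb : ∀ p : Fin 4 → Bool, (∀ j, p j = true → p (j + 2) ≠ true) →
      ∃ i, ∀ j, p j = true → j = i ∨ j = i + 1 := by decide
  obtain ⟨i, hi⟩ := comb (fun j => decide (∃ v ∈ C, blk v = some j)) fun j hj hj' => by
    rw [decide_eq_true_eq] at hj hj'
    obtain ⟨u, hu, hu'⟩ := hj
    obtain ⟨w, hw, hw'⟩ := hj'
    refine h.opposite u w j hu' hw' (hC hu hw ?_)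
    rintro rfl
    rw [hu', Option.some.injEq] at hw'
    exact absurd hw' ((by decide : ∀ j : Fin 4, j ≠ j + 2) j)
  exact ⟨i, fun v hv j hj => hi j (decide_eq_true ⟨v, hv, hj⟩)⟩

variable {I : V → Type w} [∀ v, Nontrivial (I v)]

/-- Two distinct levels of each variable, labelled by `Bool`. -/
def binaryLevel (v : V) (s : Bool) : I v :=
  if s then (exists_pair_ne (I v)).choose else (exists_pair_ne (I v)).choose_spec.choose

theorem binaryLevel_injective (v : V) : Function.Injective (binaryLevel (I := I) v) := by
  have h := (exists_pair_ne (I v)).choose_spec.choose_spec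
  intro s t hst
  cases s <;> cases t <;> simp_all [binaryLevel]

/-- The cell that is constant on each block, with the levels given by `β`, and has the level `false`
outside the blocks. -/
def blockCell (blk : V → Option (Fin 4)) (β : Fin 4 → Bool) : State I := fun v =>
  binaryLevel v ((blk v).elim false β)

theorem blockCell_of_mem {blk : V → Option (Fin 4)} {v : V} {i : Fin 4} (hv : blk v = some i)
    (β : Fin 4 → Bool) : blockCell (I := I) blk β v = binaryLevel v (β i) := by
  simp [blockCell, hv]

theorem blockCell_injective {blk : V → Option (Fin 4)} (h : IsFourCycleMinor G blk) :
    Function.Injective (blockCell (I := I) blk) := by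
  intro β γ hβγ
  funext i
  obtain ⟨u, -, hu, -⟩ := h.consecutive i
  have := congrFun hβγ u
  rw [blockCell_of_mem hu, blockCell_of_mem hu] at this
  exact binaryLevel_injective u this

theorem blockCell_congr {blk : V → Option (Fin 4)} {C : Finset V} {i : Fin 4}
    (hi : ∀ v ∈ C, ∀ j, blk v = some j → j = i ∨ j = i + 1) {β γ : Fin 4 → Bool}
    (h0 : β i = γ i) (h1 : β (i + 1) = γ (i + 1)) :
    ∀ v ∈ C, blockCell (I := I) blk β v = blockCell blk γ v := by
  intro v hv
  unfold blockCell
  cases hb : blk v with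
  | none => rfl
  | some j =>
    rcases hi v hv j hb with rfl | rfl
    · simp [h0]
    · simp [h1]

/-- The table on all cells with the entries `φ β` at the block cells and `0` elsewhere. -/
def blockTable {S : Type*} [Zero S] (blk : V → Option (Fin 4)) (φ : (Fin 4 → Bool) → S) :
    State I → S :=
  Function.extend (blockCell blk) φ fun _ => 0

theorem blockTable_blockCell {S : Type*} [Zero S] {blk : V → Option (Fin 4)}
    (h : IsFourCycleMinor G blk) (φ : (Fin 4 → Bool) → S) (β : Fin 4 → Bool) :
    blockTable (I := I) blk φ (blockCell blk β) = φ β :=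
  (blockCell_injective h).extend_apply φ _ β

theorem blockTable_of_notMem {S : Type*} [Zero S] {blk : V → Option (Fin 4)}
    (φ : (Fin 4 → Bool) → S) {x : State I} (hx : ¬ ∃ β, blockCell blk β = x) :
    blockTable blk φ x = 0 :=
  Function.extend_apply' φ _ x hx

variable [Fintype V] [DecidableEq V] [∀ v, Fintype (I v)] [∀ v, DecidableEq (I v)]
  {blk : V → Option (Fin 4)}

theorem sum_mul_blockTable {S : Type*} [CommSemiring S] (h : IsFourCycleMinor G blk)
    (φ : (Fin 4 → Bool) → S) (k : State I → S) :
    ∑ x, k x * blockTable blk φ x = ∑ β, k (blockCell blk β) * φ β := by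
  classical
  refine (Finset.sum_subset (Finset.subset_univ (Finset.univ.image (blockCell blk)))
    fun x _ hx => ?_).symm.trans ?_
  · rw [blockTable_of_notMem φ fun ⟨β, hβ⟩ => hx (Finset.mem_image.2 ⟨β, Finset.mem_univ β, hβ⟩),
      mul_zero]
  · rw [Finset.sum_image (blockCell_injective h).injOn]
    simp only [blockTable_blockCell h]

/-- Tables on the four-cycle with the same marginals on its edges give block tables with the same
clique marginals. -/
theorem blockTable_marginals_eq {S : Type*} [CommSemiring S] (h : IsFourCycleMinor G blk)
    {φ φ' : (Fin 4 → Bool) → S}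
    (hφ : ∀ (i : Fin 4) (k : Bool → Bool → S),
      ∑ β, k (β i) (β (i + 1)) * φ β = ∑ β, k (β i) (β (i + 1)) * φ' β)
    (r : CliqueRow G I) :
    ∑ x, (cliqueMatrix G I r x : S) * blockTable blk φ x =
      ∑ x, (cliqueMatrix G I r x : S) * blockTable blk φ' x := by
  obtain ⟨C, c⟩ := r
  rw [sum_mul_blockTable h, sum_mul_blockTable h]
  obtain ⟨i, hi⟩ := h.clique_blocks C.2.1
  have hne : i + 1 ≠ i := (by decide : ∀ i : Fin 4, i + 1 ≠ i) i
  let k : Bool → Bool → S := fun s t =>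
    (cliqueMatrix G I ⟨C, c⟩ (blockCell blk fun j => if j = i then s else t) : S)
  have hk : ∀ β : Fin 4 → Bool,
      (cliqueMatrix G I ⟨C, c⟩ (blockCell blk β) : S) = k (β i) (β (i + 1)) := by
    intro β
    have hcong := blockCell_congr (I := I) hi (β := β)
      (γ := fun j => if j = i then β i else β (i + 1)) (by simp) (by simp [hne])
    have : (∀ v : {v // v ∈ C.1}, blockCell (I := I) blk β v = c v) ↔
        ∀ v : {v // v ∈ C.1}, blockCell (I := I) blk
          (fun j => if j = i then β i else β (i + 1)) v = c v :=
      forall_congr' fun v => by rw [hcong v v.2]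
    simp only [k, cliqueMatrix, this]
  simp only [hk]
  exact hφ i k

/-- Products of potentials on the edges of the four-cycle, placed on the block cells, lie in the
image of the monomial map. That a cell is a block cell is itself a product of conditions on single
vertices and on the edges inside the blocks. -/
theorem blockTable_mem_imagePhi (h : IsFourCycleMinor G blk) {ψ : Fin 4 → Bool → Bool → ℝ}
    (hψ : ∀ i s t, 0 ≤ ψ i s t) :
    blockTable blk (fun β => ∏ i, ψ i (β i) (β (i + 1))) ∈ imagePhi (cliqueMatrix G I) := by
  classical
  choose p q hp hq hpq using h.consecutive
  let dec : ∀ v, I v → Bool := fun v c => decide (c = binaryLevel v true)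
  have hdec : ∀ v s, dec v (binaryLevel v s) = s := by
    intro v s
    have := (binaryLevel_injective (I := I) v).eq_iff (a := s) (b := true)
    simp only [dec, this]
    cases s <;> rfl
  let single : V → State I → ℝ := fun v x =>
    if ∃ s, x v = binaryLevel v s ∧ (blk v = none → s = false) then 1 else 0
  let pair : V × V → State I → ℝ := fun e x =>
    if G.Adj e.1 e.2 ∧ blk e.1 = blk e.2 ∧ blk e.1 ≠ none ∧
      dec e.1 (x e.1) ≠ dec e.2 (x e.2) then 0 else 1
  let edge : Fin 4 → State I → ℝ := fun i x => ψ i (dec (p i) (x (p i))) (dec (q i) (x (q i)))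
  have hsingle : ∀ v, single v ∈ imagePhi (cliqueMatrix G I) := fun v => by
    refine mem_imagePhi_of_clique (s := {v}) (by simp) (fun x => ?_) fun x y hxy => ?_
    · simp only [single]; split_ifs <;> norm_num
    · simp only [single, hxy v (by simp)]
  have hpair : ∀ e, pair e ∈ imagePhi (cliqueMatrix G I) := fun e => by
    by_cases he : G.Adj e.1 e.2
    · refine mem_imagePhi_of_clique (s := {e.1, e.2})
        (by simpa [SimpleGraph.isClique_pair] using fun _ => he) (fun x => ?_) fun x y hxy => ?_
      · simp only [pair]; split_ifs <;> norm_num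
      · simp only [pair, hxy e.1 (by simp), hxy e.2 (by simp)]
    · have : pair e = fun _ => 1 := funext fun x => if_neg fun h => he h.1
      exact this ▸ one_mem_imagePhi
  have hedge : ∀ i, edge i ∈ imagePhi (cliqueMatrix G I) := fun i => by
    refine mem_imagePhi_of_clique (s := {p i, q i})
      (by simpa [SimpleGraph.isClique_pair] using fun _ => hpq i) (fun x => hψ _ _ _)
      fun x y hxy => ?_
    simp only [edge, hxy (p i) (by simp), hxy (q i) (by simp)]
  have heq : blockTable blk (fun β => ∏ i, ψ i (β i) (β (i + 1))) = fun x =>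
      ((∏ v, single v x) * ∏ e, pair e x) * ∏ i, edge i x := by
    funext x
    by_cases hx : ∃ β, blockCell blk β = x
    · obtain ⟨β, rfl⟩ := hx
      have h1 : ∀ v, single v (blockCell blk β) = 1 := fun v =>
        if_pos ⟨(blk v).elim false β, rfl, fun hv => by simp [hv]⟩
      have h2 : ∀ e, pair e (blockCell blk β) = 1 := fun e =>
        if_neg fun ⟨_, he, _, hne⟩ => hne (by simp only [blockCell, hdec, he])
      have h3 : ∀ i, edge i (blockCell blk β) = ψ i (β i) (β (i + 1)) := fun i => by
        simp only [edge, blockCell_of_mem (hp i), blockCell_of_mem (hq i), hdec]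
      simp only [blockTable_blockCell h, h1, h2, h3, Finset.prod_const_one, one_mul]
    · rw [blockTable_of_notMem _ hx]
      symm
      suffices (∏ v, single v x) * ∏ e, pair e x = 0 by rw [this, zero_mul]
      by_contra hne
      obtain ⟨hne1, hne2⟩ := mul_ne_zero_iff.1 hne
      have h1 : ∀ v, ∃ s, x v = binaryLevel v s ∧ (blk v = none → s = false) := fun v => by
        by_contra hv
        exact Finset.prod_ne_zero_iff.1 hne1 v (Finset.mem_univ v) (if_neg hv)
      have h2 : ∀ u w, G.Adj u w → blk u = blk w → blk u ≠ none →
          dec u (x u) = dec w (x w) := fun u w huw hb hb' => by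
        by_contra hd
        exact Finset.prod_ne_zero_iff.1 hne2 (u, w) (Finset.mem_univ _) (if_pos ⟨huw, hb, hb', hd⟩)
      refine hx ⟨fun i => dec (p i) (x (p i)), funext fun v => ?_⟩
      obtain ⟨s, hs, hs'⟩ := h1 v
      cases hb : blk v with
      | none => simp [blockCell, hb, hs, hs' hb]
      | some i =>
        rw [blockCell_of_mem hb, hs]
        congr 1
        have := h.connected i {u | dec u (x u) = dec (p i) (x (p i))}
          (fun u hu w hw huw (hu' : _ = _) => by
            have hu : blk u = some i := hu
            have hw : blk w = some i := hw
            exact (h2 u w huw (hu.trans hw.symm) (by simp [hu])).symm.trans hu')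
          (p i) (hp i) v hb rfl
        have this : dec v (x v) = dec (p i) (x (p i)) := this
        rw [← this, hs, hdec]
  rw [heq]
  exact mul_mem_imagePhi (mul_mem_imagePhi (prod_mem_imagePhi _ _ fun v _ => hsingle v)
    (prod_mem_imagePhi _ _ fun e _ => hpair e)) (prod_mem_imagePhi _ _ fun i _ => hedge i)

/-! ### The image is not closed over a four-cycle minor -/

/-- Disagreement along the first three edges of the four-cycle and agreement along the last cost
one unit each. The cycle forces an odd total cost. -/
def edgeCost (i : Fin 4) (s t : Bool) : ℕ := if (i = 3) = (s = t) then 1 else 0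

/-- The total cost of a configuration on the four-cycle. -/
def cycleCost (β : Fin 4 → Bool) : ℕ := ∑ i, edgeCost i (β i) (β (i + 1))

theorem cycleCost_eq (β : Fin 4 → Bool) : cycleCost β = 1 ∨ cycleCost β = 3 := by
  revert β; unfold cycleCost edgeCost; decide

/-- The indicator of the configurations of least cost is the limit of the tables
`ε ^ (cycleCost β - 1)`. It is not in the image, because every clique marginal of the alternating
configuration, which has larger cost, is also met by a configuration of least cost. -/
theorem IsFourCycleMinor.not_isClosed_imagePhi (h : IsFourCycleMinor G blk) :
    ¬ IsClosed (imagePhi (cliqueMatrix G I)) := by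
  classical
  intro hcl
  let F : ℝ → State I → ℝ := fun ε => blockTable blk fun β => if cycleCost β = 1 then 1 else ε ^ 2
  have hF : ∀ ε : ℝ, 0 < ε → F ε ∈ imagePhi (cliqueMatrix G I) := by
    intro ε hε
    have := mul_mem_imagePhi (const_mem_imagePhi (inv_nonneg.2 hε.le))
      (blockTable_mem_imagePhi (I := I) h (ψ := fun i s t => ε ^ edgeCost i s t)
        fun i s t => by positivity)
    convert this using 1
    funext x
    by_cases hx : ∃ β, blockCell blk β = x
    · obtain ⟨β, rfl⟩ := hx
      simp only [F, blockTable_blockCell h]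
      rw [Finset.prod_pow_eq_pow_sum]
      change _ = ε⁻¹ * ε ^ cycleCost β
      rcases cycleCost_eq β with hc | hc
      · simp [hc, hε.ne']
      · rw [hc, if_neg (by norm_num)]
        field_simp
    · simp only [F, blockTable_of_notMem _ hx, mul_zero]
  have hF0 : F 0 ∈ imagePhi (cliqueMatrix G I) := by
    have hcont : ContinuousWithinAt F (Set.Ioi 0) 0 := by
      refine Continuous.continuousWithinAt (continuous_pi fun x => ?_)
      by_cases hx : ∃ β, blockCell blk β = x
      · obtain ⟨β, rfl⟩ := hx
        simp only [F, blockTable_blockCell h]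
        split_ifs <;> fun_prop
      · simp only [F, blockTable_of_notMem _ hx]
        exact continuous_const
    have h0 : (0 : ℝ) ∈ closure (Set.Ioi (0 : ℝ)) := by simp [closure_Ioi]
    rw [← hcl.closure_eq]
    exact hcont.mem_closure h0 hF
  obtain ⟨t, ht, hphi⟩ := hF0
  let β₀ : Fin 4 → Bool := ![false, true, false, true]
  have hβ₀ : cycleCost β₀ ≠ 1 := by unfold cycleCost edgeCost; decide
  have hzero : phi (cliqueMatrix G I) t (blockCell blk β₀) = 0 := by
    rw [hphi]
    simp [F, blockTable_blockCell h, hβ₀]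
  rw [phi_cliqueMatrix, Finset.prod_eq_zero_iff] at hzero
  obtain ⟨C, -, hC⟩ := hzero
  obtain ⟨i, hi⟩ := h.clique_blocks C.2.1
  have hcomb : ∀ i : Fin 4, ∃ β : Fin 4 → Bool, cycleCost β = 1 ∧
      β₀ i = β i ∧ β₀ (i + 1) = β (i + 1) := by
    unfold cycleCost edgeCost; decide
  obtain ⟨β, hβ, hβi, hβi'⟩ := hcomb i
  have hone : phi (cliqueMatrix G I) t (blockCell blk β) = 1 := by
    rw [hphi]
    simp [F, blockTable_blockCell h, hβ]
  rw [phi_cliqueMatrix] at hone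
  have hne := Finset.prod_ne_zero_iff.1 (hone.trans_ne one_ne_zero) C (Finset.mem_univ C)
  refine hne ?_
  rw [← hC]
  congr 2
  funext v
  exact (blockCell_congr hi hβi hβi' v v.2).symm

/-! ### Separation binomials do not generate the toric ideal over a four-cycle minor -/

theorem sum_fin_four_bool {M : Type*} [AddCommMonoid M] (f : (Fin 4 → Bool) → M) :
    ∑ β, f β = ∑ a, ∑ b, ∑ c, ∑ d, f ![a, b, c, d] := by
  have : Function.Bijective fun x : Bool × Bool × Bool × Bool => ![x.1, x.2.1, x.2.2.1, x.2.2.2] := by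
    refine ⟨?_, fun β => ⟨(β 0, β 1, β 2, β 3), ?_⟩⟩
    · decide
    · funext i; fin_cases i <;> rfl
  rw [← this.sum_comp f]
  simp only [Fintype.sum_prod_type]

/-- Configurations that agree along the first edge and have parity `e` at the last three vertices.
For `e = 0` and `e = 1` they have the same edge marginals. -/
def parityTable (S : Type*) [Zero S] [One S] (e : Bool) (β : Fin 4 → Bool) : S :=
  if β 0 = β 1 ∧ (β 1 ^^ β 2 ^^ β 3) = e then 1 else 0

theorem parityTable_edge_marginals (i : Fin 4) (k : Bool → Bool → ℕ) :
    ∑ β, k (β i) (β (i + 1)) * parityTable ℕ false β =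
      ∑ β, k (β i) (β (i + 1)) * parityTable ℕ true β := by
  rw [sum_fin_four_bool, sum_fin_four_bool]
  fin_cases i <;> simp [parityTable] <;> ring

/-- Two different configurations of even parity differ on a connected set of blocks. Hence a
separator on which their cells agree leaves all blocks where they differ on one side, and the
indicator of these cells is globally Markov. -/
theorem globalMarkov_parityTable (h : IsFourCycleMinor G blk) :
    GlobalMarkov G (blockTable (I := I) blk (parityTable ℝ false)) := by
  classical
  set P : State I → ℝ := blockTable blk (parityTable ℝ false) with hP
  have hval : ∀ x, P x ≠ 0 → ∃ β, blockCell blk β = x ∧ parityTable ℝ false β ≠ 0 := by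
    intro x hx
    by_cases hβ : ∃ β, blockCell blk β = x
    · obtain ⟨β, rfl⟩ := hβ
      exact ⟨β, rfl, by rwa [hP, blockTable_blockCell h] at hx⟩
    · exact absurd (blockTable_of_notMem _ hβ) hx
  have key : ∀ A B S : Finset V, SaturatedSeparation G A B S → ∀ r r' : State I,
      (∀ v ∈ S, r v = r' v) → P r * P r' ≠ 0 →
      P (A.piecewise r' r) * P (A.piecewise r r') = P r * P r' := by
    intro A B S hs r r' hS hne
    obtain ⟨hr, hr'⟩ := mul_ne_zero_iff.1 hne
    obtain ⟨β, rfl, hβ⟩ := hval r hr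
    obtain ⟨γ, rfl, hγ⟩ := hval r' hr'
    have hparity : ∀ β γ : Fin 4 → Bool, (β 0 = β 1 ∧ (β 1 ^^ β 2 ^^ β 3) = false) →
        (γ 0 = γ 1 ∧ (γ 1 ^^ γ 2 ^^ γ 3) = false) → ∀ i, β i ≠ γ i → β (i + 2) ≠ γ (i + 2) →
        β (i + 1) ≠ γ (i + 1) ∨ β (i + 3) ≠ γ (i + 3) := by decide
    have hβ' : β 0 = β 1 ∧ (β 1 ^^ β 2 ^^ β 3) = false := by
      by_contra hcon
      exact hβ (if_neg hcon)
    have hγ' : γ 0 = γ 1 ∧ (γ 1 ^^ γ 2 ^^ γ 3) = false := by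
      by_contra hcon
      exact hγ (if_neg hcon)
    have hdiff : ∀ i, β i ≠ γ i → ∀ v, blk v = some i →
        blockCell (I := I) blk β v ≠ blockCell blk γ v := by
      intro i hi v hv
      rw [blockCell_of_mem hv, blockCell_of_mem hv]
      exact (binaryLevel_injective v).ne hi
    have hAB : ∀ i, β i ≠ γ i → ∀ v, blk v = some i → v ∉ A → v ∈ B := by
      intro i hi v hv hvA
      by_contra hvB
      exact hdiff i hi v hv (hS v (hs.mem_of_notMem hvA hvB))
    -- a block where the configurations differ lies on one side
    have hblock : ∀ i, β i ≠ γ i → ∀ u w, blk u = some i → blk w = some i → u ∈ A → w ∈ A := by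
      intro i hi u w hu hw huA
      refine h.connected i (A : Set V) (fun a ha b hb hab haA => ?_) u hu w hw huA
      by_contra hbA
      exact hs.not_adj haA (hAB i hi b hb hbA) hab
    -- so do two consecutive such blocks
    have hnext : ∀ i, β i ≠ γ i → β (i + 1) ≠ γ (i + 1) → ∀ u w, blk u = some i →
        blk w = some (i + 1) → (u ∈ A ↔ w ∈ A) := by
      intro i hi hi' u w hu hw
      obtain ⟨p, q, hp, hq, hpq⟩ := h.consecutive i
      constructor
      · intro huA
        refine hblock _ hi' q w hq hw ?_
        by_contra hqA
        exact hs.not_adj (hblock i hi u p hu hp huA) (hAB _ hi' q hq hqA) hpq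
      · intro hwA
        refine hblock i hi p u hp hu ?_
        by_contra hpA
        exact hs.not_adj (hblock _ hi' w q hw hq hwA) (hAB i hi p hp hpA) hpq.symm
    have hall : ∀ i j, β i ≠ γ i → β j ≠ γ j → ∀ u w, blk u = some i → blk w = some j →
        u ∈ A → w ∈ A := by
      intro i j hi hj u w hu hw huA
      have hcase : ∀ i j : Fin 4, j = i ∨ j = i + 1 ∨ j = i + 2 ∨ j + 1 = i := by decide
      have h2 : ∀ i : Fin 4, i + 1 + 1 = i + 2 := by decide
      have h3 : ∀ i : Fin 4, i + 3 + 1 = i := by decide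
      have h4 : ∀ i : Fin 4, i + 2 + 1 = i + 3 := by decide
      rcases hcase i j with rfl | rfl | rfl | rfl
      · exact hblock _ hi u w hu hw huA
      · exact (hnext i hi hj u w hu hw).1 huA
      · rcases hparity β γ hβ' hγ' i hi hj with hm | hm
        · obtain ⟨z, -, hz, -⟩ := h.consecutive (i + 1)
          have hz' := (hnext i hi hm u z hu hz).1 huA
          exact (hnext (i + 1) hm ((h2 i).symm ▸ hj) z w hz ((h2 i).symm ▸ hw)).1 hz'
        · obtain ⟨z, -, hz, -⟩ := h.consecutive (i + 3)
          have hz' := (hnext (i + 3) hm ((h3 i).symm ▸ hi) z u hz ((h3 i).symm ▸ hu)).2 huA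
          exact (hnext (i + 2) hj ((h4 i).symm ▸ hm) w z hw ((h4 i).symm ▸ hz)).2 hz'
      · exact (hnext j hj hi w u hw hu).2 huA
    have hblk : ∀ v, blockCell (I := I) blk β v ≠ blockCell blk γ v →
        ∃ i, blk v = some i ∧ β i ≠ γ i := by
      intro v hv
      cases hb : blk v with
      | none => exact absurd (by simp [blockCell, hb]) hv
      | some i =>
        refine ⟨i, rfl, fun he => hv ?_⟩
        rw [blockCell_of_mem hb, blockCell_of_mem hb, he]
    by_cases hA : ∃ u ∈ A, blockCell (I := I) blk β u ≠ blockCell blk γ u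
    · obtain ⟨u, huA, hu⟩ := hA
      obtain ⟨i, hui, hi⟩ := hblk u hu
      have hoff : ∀ w, w ∉ A → blockCell (I := I) blk β w = blockCell blk γ w := by
        intro w hw
        by_contra hne
        obtain ⟨j, hwj, hj⟩ := hblk w hne
        exact hw (hall i j hi hj u w hui hwj huA)
      have e1 : A.piecewise (blockCell (I := I) blk γ) (blockCell blk β) = blockCell blk γ := by
        funext w; by_cases hw : w ∈ A <;> simp [hw, hoff]
      have e2 : A.piecewise (blockCell (I := I) blk β) (blockCell blk γ) = blockCell blk β := by
        funext w; by_cases hw : w ∈ A <;> simp [hw, hoff]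
      rw [e1, e2, mul_comm]
    · push Not at hA
      have e1 : A.piecewise (blockCell (I := I) blk γ) (blockCell blk β) = blockCell blk β := by
        funext w; by_cases hw : w ∈ A <;> simp [hw, hA]
      have e2 : A.piecewise (blockCell (I := I) blk β) (blockCell blk γ) = blockCell blk γ := by
        funext w; by_cases hw : w ∈ A <;> simp [hw, hA]
      rw [e1, e2]
  intro A B S hs r r' hS
  by_cases hne : P r * P r' = 0
  · by_contra hcon
    rw [hne] at hcon
    have hSA : ∀ v ∈ S, v ∉ A := fun v hv hA => Finset.disjoint_left.1 hs.2.1 hA hv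
    have := key A B S hs (A.piecewise r' r) (A.piecewise r r')
      (fun v hv => by simp [hSA v hv, hS v hv]) (Ne.symm hcon)
    have e1 : A.piecewise (A.piecewise r r') (A.piecewise r' r) = r := by
      funext w; by_cases hw : w ∈ A <;> simp [hw]
    have e2 : A.piecewise (A.piecewise r' r) (A.piecewise r r') = r' := by
      funext w; by_cases hw : w ∈ A <;> simp [hw]
    rw [e1, e2, hne] at this
    exact hcon this
  · exact (key A B S hs r r' hS hne).symm

/-- The quartic binomial of the two parity classes lies in the toric ideal, but it does not vanish
at the indicator of one class, where all binomials of separation statements do. -/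
theorem IsFourCycleMinor.span_ne_toricIdeal (h : IsFourCycleMinor G blk)
    {B : Set (MvPolynomial (State I) ℝ)} (hB : B ⊆ globalBinomials G I) :
    Ideal.span B ≠ toricIdeal (cliqueMatrix G I) := by
  classical
  intro hspan
  set P : State I → ℝ := blockTable blk (parityTable ℝ false)
  have hvan : ∀ f ∈ toricIdeal (cliqueMatrix G I), eval P f = 0 := by
    intro f hf
    rw [← hspan] at hf
    have : Ideal.span B ≤ RingHom.ker (eval P) := Ideal.span_le.2 fun g hg =>
      (globalMarkov_iff P).1 (globalMarkov_parityTable h) g (hB hg)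
    exact this hf
  let T : Bool → State I →₀ ℕ := fun e =>
    Finsupp.equivFunOnFinite.symm (blockTable blk (parityTable ℕ e))
  have hT : ∀ e x, T e x = blockTable blk (parityTable ℕ e) x := fun e x => rfl
  have hmem : (monomial (T false) 1 - monomial (T true) 1 : MvPolynomial (State I) ℝ) ∈
      toricIdeal (cliqueMatrix G I) := by
    refine Ideal.subset_span ⟨T false, T true, funext fun r => ?_, rfl⟩
    have := blockTable_marginals_eq (I := I) (S := ℕ) h parityTable_edge_marginals r
    simpa only [Matrix.mulVec, dotProduct, hT, Nat.cast_id] using this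
  have hev : ∀ u : State I →₀ ℕ, eval P (monomial u 1) = ∏ x, P x ^ u x := fun u => by
    rw [eval_monomial, one_mul, Finsupp.prod_fintype _ _ (by simp)]
  have h0 := hvan _ hmem
  rw [map_sub, hev, hev, sub_eq_zero] at h0
  have h1 : ∏ x, P x ^ T false x = 1 := by
    refine Finset.prod_eq_one fun x _ => ?_
    rw [hT]
    by_cases hx : ∃ β, blockCell blk β = x
    · obtain ⟨β, rfl⟩ := hx
      simp only [P, blockTable_blockCell h, parityTable]
      split_ifs <;> simp
    · simp only [blockTable_of_notMem _ hx, pow_zero]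
  have h2 : ∏ x, P x ^ T true x = 0 := by
    refine Finset.prod_eq_zero (Finset.mem_univ (blockCell blk ![false, false, false, true])) ?_
    rw [hT]
    simp [P, blockTable_blockCell h, parityTable]
  rw [h1, h2] at h0
  exact one_ne_zero h0

end Minor

end

/-! ### Maximum likelihood over a four-cycle minor is not rational -/

section

open Filter Topology

section Polynomials

open Polynomial

theorem eq_zero_of_eval_natCast {P : ℝ[X]} (h : ∀ n : ℕ, 1 ≤ n → P.eval (n : ℝ) = 0) : P = 0 := by
  refine P.eq_zero_of_infinite_isRoot ((Set.infinite_of_injective_forall_mem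
    (f := fun n : ℕ => ((n + 1 : ℕ) : ℝ)) (fun a b hab => ?_) fun n => h (n + 1) (by omega)))
  simpa using hab

theorem eventually_eval_natCast_ne_zero {P : ℝ[X]} (hP : P ≠ 0) :
    ∀ᶠ k : ℕ in atTop, P.eval (k : ℝ) ≠ 0 :=
  tendsto_natCast_atTop_atTop.eventually (P.eventually_atTop_not_isRoot hP)

/-- A bounded quotient of polynomials converges along the natural numbers to the quotient of the
coefficients at the degree of the denominator. -/
theorem tendsto_eval_div_of_bounded {P Q : ℝ[X]} (hQ : Q ≠ 0)
    (hb : ∀ᶠ k : ℕ in atTop, |P.eval (k : ℝ) / Q.eval (k : ℝ)| ≤ 1) :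
    Tendsto (fun k : ℕ => P.eval (k : ℝ) / Q.eval (k : ℝ)) atTop
      (𝓝 (P.coeff Q.natDegree / Q.leadingCoeff)) := by
  rcases lt_trichotomy P.degree Q.degree with hlt | heq | hgt
  · have h0 : P.coeff Q.natDegree = 0 := by
      refine coeff_eq_zero_of_degree_lt ?_
      rwa [← degree_eq_natDegree hQ]
    rw [h0, zero_div]
    exact (P.div_tendsto_atTop_zero_of_degree_lt Q hlt).comp tendsto_natCast_atTop_atTop
  · rw [← natDegree_eq_of_degree_eq heq]
    exact (P.div_tendsto_atTop_leadingCoeff_div_of_degree_eq Q heq).comp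
      tendsto_natCast_atTop_atTop
  · have := (P.abs_div_tendsto_atTop_atTop_of_degree_gt Q hgt hQ).comp
      (tendsto_natCast_atTop_atTop (R := ℝ))
    obtain ⟨k, hk1, hk2⟩ := (hb.and (this.eventually_gt_atTop 1)).exists
    exact absurd hk2 (not_lt.2 hk1)

/-- The quadratic equation `Q² - 3 (n - 1) Q - n = 0` has no solution that is a rational function
of `n`: its discriminant `9 n² - 14 n + 9` has no real root, hence is prime in `ℝ[n]`, and cannot
be a square. -/
theorem quadratic_not_rational {α β : ℝ[X]} (hβ : β ≠ 0)
    (h : α ^ 2 = 3 * (X - 1) * α * β + X * β ^ 2) : False := by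
  set D : ℝ[X] := C 9 * X ^ 2 + C (-14) * X + C 9 with hD
  have hdeg : D.natDegree = 2 := natDegree_quadratic (by norm_num)
  have hsq : (2 * α - 3 * (X - 1) * β) ^ 2 = D * β ^ 2 := by
    have h9 : (C 9 : ℝ[X]) = 9 := map_ofNat C 9
    have h14 : (C (-14) : ℝ[X]) = -14 := by rw [map_neg, map_ofNat C 14]
    rw [hD, h9, h14]
    linear_combination 4 * h
  have hirr : Irreducible D := by
    refine (irreducible_iff_roots_eq_zero_of_degree_le_three (by omega) (by omega)).2 ?_
    refine Multiset.eq_zero_of_forall_notMem fun x hx => ?_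
    have := (isRoot_of_mem_roots hx)
    simp only [IsRoot, hD, eval_add, eval_mul, eval_C, eval_pow, eval_X] at this
    nlinarith [sq_nonneg (9 * x - 7)]
  have hp := hirr.prime
  have hD0 := hirr.ne_zero
  have hne : D * β ^ 2 ≠ 0 := mul_ne_zero hD0 (pow_ne_zero 2 hβ)
  have h1 : FiniteMultiplicity D (2 * α - 3 * (X - 1) * β) :=
    .of_prime_left hp fun h0 => hne (by rw [← hsq, h0]; ring)
  have h2 : FiniteMultiplicity D β := .of_prime_left hp hβ
  have h3 : FiniteMultiplicity D D := .of_prime_left hp hD0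
  have := congrArg (emultiplicity D) hsq
  rw [emultiplicity_pow hp, emultiplicity_mul hp, emultiplicity_pow hp, h3.emultiplicity_self,
    h1.emultiplicity_eq_multiplicity, h2.emultiplicity_eq_multiplicity] at this
  norm_cast at this
  omega

end Polynomials

section Irrational

variable {V : Type u} [Fintype V] [DecidableEq V] {G : SimpleGraph V}
  {I : V → Type w} [∀ v, Fintype (I v)] [∀ v, DecidableEq (I v)] [∀ v, Nontrivial (I v)]
  {blk : V → Option (Fin 4)}

/-- Symmetric counts on the four-cycle: `1` for the constant configurations, `n` for the alternating
ones. -/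
def cycleCounts {S : Type*} [Zero S] [One S] (n : S) (β : Fin 4 → Bool) : S :=
  if β 0 = β 1 ∧ β 1 = β 2 ∧ β 2 = β 3 then 1
  else if β 0 ≠ β 1 ∧ β 1 ≠ β 2 ∧ β 2 ≠ β 3 then n else 0

/-- The weight `q ^ (number of disagreements)` of a configuration on the four-cycle. -/
def disagreementWeight (q : ℝ) (β : Fin 4 → Bool) : ℝ :=
  ∏ i, if β i = β (i + 1) then 1 else q

/-- If `q ^ 2` solves the quadratic equation, then the weights and the counts have proportional edge
marginals. -/
theorem disagreementWeight_edge_marginals {q n : ℝ} (hq : (q ^ 2) ^ 2 = 3 * (n - 1) * q ^ 2 + n)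
    (i : Fin 4) (k : Bool → Bool → ℝ) :
    ∑ β, k (β i) (β (i + 1)) * disagreementWeight q β =
      ∑ β, k (β i) (β (i + 1)) * ((1 + 3 * q ^ 2) * cycleCounts n β) := by
  rw [sum_fin_four_bool, sum_fin_four_bool]
  fin_cases i <;> simp [disagreementWeight, cycleCounts, Fin.prod_univ_four] <;>
    linear_combination (k true false + k false true) * hq

theorem map_blockTable {S T : Type*} [Zero S] [Zero T] (h : IsFourCycleMinor G blk)
    (e : S → T) (he : e 0 = 0) (φ : (Fin 4 → Bool) → S) (x : State I) :
    e (blockTable blk φ x) = blockTable blk (fun β => e (φ β)) x := by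
  by_cases hx : ∃ β, blockCell blk β = x
  · obtain ⟨β, rfl⟩ := hx
    simp only [blockTable_blockCell h]
  · simp only [blockTable_of_notMem _ hx, he]

/-- The counts `k c + w`, where `c` is the symmetric table with parameter `n` on the block cells. -/
def tiltedCounts (blk : V → Option (Fin 4)) (w : State I → ℕ) (n k : ℕ) (x : State I) : ℕ :=
  k * blockTable blk (cycleCounts n) x + w x

/-- Substitution of the counts `k c + w` into a polynomial, as a polynomial in `k` whose
coefficients are polynomials in `n`. -/
def tiltHom (K : Subfield ℝ) (blk : V → Option (Fin 4)) (w : State I → ℕ) :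
    MvPolynomial (State I) K →+* Polynomial (Polynomial ℝ) :=
  MvPolynomial.eval₂Hom ((Polynomial.C.comp Polynomial.C).comp (algebraMap K ℝ)) fun x =>
    Polynomial.C (blockTable blk (cycleCounts Polynomial.X) x) * Polynomial.X +
      Polynomial.C (Polynomial.C (w x : ℝ))

theorem eval_tiltHom (K : Subfield ℝ) (h : IsFourCycleMinor G blk) (w : State I → ℕ)
    (n k : ℕ) (f : MvPolynomial (State I) K) :
    ((tiltHom K blk w f).map (Polynomial.evalRingHom (n : ℝ))).eval (k : ℝ) =
      MvPolynomial.aeval (fun x => (tiltedCounts blk w n k x : ℝ)) f := by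
  have hc : ∀ x, (blockTable (I := I) blk (cycleCounts (Polynomial.X : Polynomial ℝ)) x).eval
      (n : ℝ) = (blockTable blk (cycleCounts n) x : ℕ) := by
    intro x
    rw [map_blockTable h (fun p : Polynomial ℝ => p.eval (n : ℝ)) Polynomial.eval_zero,
      map_blockTable h (fun m : ℕ => (m : ℝ)) Nat.cast_zero]
    congr 1
    funext β
    simp only [cycleCounts]
    split_ifs <;> simp
  induction f using MvPolynomial.induction_on with
  | C a => simp [tiltHom]
  | add p q hp hq => simp only [map_add, Polynomial.map_add, Polynomial.eval_add, hp, hq]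
  | mul_X p x hp =>
    simp only [map_mul, Polynomial.map_mul, Polynomial.eval_mul, hp, MvPolynomial.aeval_X]
    congr 1
    simp only [tiltHom, MvPolynomial.coe_eval₂Hom, MvPolynomial.eval₂_X, Polynomial.map_add,
      Polynomial.map_mul, Polynomial.map_C, Polynomial.map_X, Polynomial.eval_add,
      Polynomial.eval_mul, Polynomial.eval_C, Polynomial.eval_X, Polynomial.coe_evalRingHom, hc,
      tiltedCounts, Nat.cast_add, Nat.cast_mul]
    ring

theorem exists_natCast_aeval_ne_zero {σ : Type*} (K : Subfield ℝ) {f : MvPolynomial σ K}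
    (hf : f ≠ 0) : ∃ w : σ → ℕ, MvPolynomial.aeval (fun x => (w x : ℝ)) f ≠ 0 := by
  by_contra! hcon
  refine hf (MvPolynomial.funext_set (fun _ => Set.range (Nat.cast : ℕ → K))
    (fun _ => Set.infinite_range_of_injective Nat.cast_injective) fun x hx => ?_)
  choose w hw using fun i => hx i (Set.mem_univ i)
  have := hcon w
  have hx' : (fun i => (w i : ℝ)) = algebraMap K ℝ ∘ x := funext fun i => by
    rw [Function.comp_apply, ← hw i, map_natCast]
  rw [hx', MvPolynomial.aeval_algebraMap_apply, MvPolynomial.aeval_eq_eval] at this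
  rw [map_zero]
  exact (map_eq_zero (algebraMap K ℝ)).1 this

/-- The distribution proportional to `q ^ (number of disagreements)` on the block cells. -/
theorem disagreement_mem_extendedModel (h : IsFourCycleMinor G blk) {q : ℝ} (hq : 0 < q) :
    0 < ∑ β, disagreementWeight q β ∧
    (fun x => (∑ β, disagreementWeight q β)⁻¹ * blockTable blk (disagreementWeight q) x) ∈
      extendedModel (cliqueMatrix G I) := by
  have hw : ∀ β, 0 < disagreementWeight q β := fun β =>
    Finset.prod_pos fun i _ => by split_ifs <;> positivity
  have hZ : 0 < ∑ β, disagreementWeight q β :=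
    Finset.sum_pos (fun β _ => hw β) Finset.univ_nonempty
  have hmem := mul_mem_imagePhi (const_mem_imagePhi (inv_nonneg.2 hZ.le))
    (blockTable_mem_imagePhi (I := I) h (ψ := fun _ s t => if s = t then 1 else q)
      fun i s t => by split_ifs <;> positivity)
  refine ⟨hZ, subset_closure ⟨hmem, nonneg_of_mem_imagePhi hmem, ?_⟩⟩
  have := sum_mul_blockTable (I := I) h (disagreementWeight q)
    fun _ => (∑ β, disagreementWeight q β)⁻¹
  rw [this, ← Finset.mul_sum, inv_mul_cancel₀ hZ.ne']

/-- The limit of the maximum likelihood estimates for the counts `k c + w` as `k` grows. It is the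
distribution in the extended model with the marginals of `c`, which is known explicitly. -/
theorem limit_eq_disagreement (h : IsFourCycleMinor G blk) {w : State I → ℕ} {n : ℕ}
    {q : ℝ} (hq : 0 < q) (hqn : (q ^ 2) ^ 2 = 3 * ((n : ℝ) - 1) * q ^ 2 + n)
    {p : ℕ → State I → ℝ} (hp : ∀ᶠ k in atTop, IsMLE (cliqueMatrix G I) (tiltedCounts blk w n k)
      (p k)) {L : State I → ℝ} (hL : Tendsto p atTop (𝓝 L)) :
    L = fun x => (∑ β, disagreementWeight q β)⁻¹ * blockTable blk (disagreementWeight q) x := by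
  obtain ⟨hZ, hmem⟩ := disagreement_mem_extendedModel (I := I) h hq
  have hLmem : L ∈ extendedModel (cliqueMatrix G I) :=
    isClosed_closure.mem_of_tendsto hL (hp.mono fun k hk => hk.1)
  refine eq_of_marginals_eq hLmem hmem fun i => ?_
  set c : State I → ℝ := blockTable blk (cycleCounts (n : ℝ)) with hc
  have hcast : ∀ x, ((blockTable (I := I) blk (cycleCounts n) x : ℕ) : ℝ) = c x := by
    intro x
    rw [map_blockTable h (fun m : ℕ => (m : ℝ)) Nat.cast_zero, hc]
    congr 1
    funext β
    simp only [cycleCounts]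
    split_ifs <;> simp
  -- the likelihood equations, divided by `k`, in the limit
  have hlim : (∑ x, c x) * ∑ x, (cliqueMatrix G I i x : ℝ) * L x =
      ∑ x, (cliqueMatrix G I i x : ℝ) * c x := by
    have hLx : ∀ x, Tendsto (fun k => p k x) atTop (𝓝 (L x)) := fun x =>
      tendsto_pi_nhds.1 hL x
    have hinv : Tendsto (fun k : ℕ => ((k : ℝ))⁻¹) atTop (𝓝 0) :=
      tendsto_inv_atTop_zero.comp tendsto_natCast_atTop_atTop
    have hu : ∀ x, Tendsto (fun k : ℕ => c x + (k : ℝ)⁻¹ * w x) atTop (𝓝 (c x)) := fun x => by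
      simpa using tendsto_const_nhds.add (hinv.mul_const (w x : ℝ))
    have hleft : Tendsto (fun k : ℕ => (∑ x, (c x + (k : ℝ)⁻¹ * w x)) *
        ∑ x, (cliqueMatrix G I i x : ℝ) * p k x) atTop
        (𝓝 ((∑ x, c x) * ∑ x, (cliqueMatrix G I i x : ℝ) * L x)) :=
      (tendsto_finsetSum _ fun x _ => hu x).mul
        (tendsto_finsetSum _ fun x _ => (hLx x).const_mul _)
    have hright : Tendsto (fun k : ℕ => ∑ x, (cliqueMatrix G I i x : ℝ) *
        (c x + (k : ℝ)⁻¹ * w x)) atTop (𝓝 (∑ x, (cliqueMatrix G I i x : ℝ) * c x)) :=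
      tendsto_finsetSum _ fun x _ => (hu x).const_mul _
    refine tendsto_nhds_unique hleft (hright.congr' ?_)
    filter_upwards [hp, eventually_ge_atTop 1] with k hk hk1
    have hk0 : (k : ℝ) ≠ 0 := by positivity
    have hmar := hk.marginals_eq (fun c => const_mem_imagePhi) i
    have hux : ∀ x, (tiltedCounts blk w n k x : ℝ) = k * (c x + (k : ℝ)⁻¹ * w x) := fun x => by
      rw [tiltedCounts, Nat.cast_add, Nat.cast_mul, hcast]
      field_simp
    simp only [hux, mul_left_comm _ (k : ℝ), ← Finset.mul_sum, mul_assoc] at hmar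
    exact (mul_left_cancel₀ hk0 hmar).symm
  have hprop : ∑ x, (cliqueMatrix G I i x : ℝ) * blockTable blk (disagreementWeight q) x =
      (1 + 3 * q ^ 2) * ∑ x, (cliqueMatrix G I i x : ℝ) * c x := by
    rw [blockTable_marginals_eq (I := I) h (disagreementWeight_edge_marginals hqn) i,
      sum_mul_blockTable h, hc, sum_mul_blockTable h, Finset.mul_sum]
    exact Finset.sum_congr rfl fun β _ => by ring
  have htotal : ∑ β, disagreementWeight q β = (1 + 3 * q ^ 2) * ∑ x, c x := by
    have h1 := disagreementWeight_edge_marginals hqn 0 fun _ _ => 1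
    have h2 := sum_mul_blockTable (I := I) h (cycleCounts (n : ℝ)) fun _ => 1
    simp only [one_mul, ← Finset.mul_sum] at h1 h2
    rw [h1, hc, h2]
  simp only [mul_left_comm _ (∑ β, disagreementWeight q β)⁻¹, ← Finset.mul_sum]
  rw [hprop, ← hlim, ← mul_assoc (1 + 3 * q ^ 2), ← htotal, inv_mul_cancel_left₀ hZ.ne']

/-- Along the counts `k c + w`, with `w` generic, a rational estimate would converge to a rational
function of the parameter `n` of `c`. The ratio of the limits at two cells solves a quadratic
equation over `ℝ(n)` that has no solution there. -/
theorem IsFourCycleMinor.not_mleIsRational (h : IsFourCycleMinor G blk) (K : Subfield ℝ) :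
    ¬ MLEIsRational (cliqueMatrix G I) K := by
  classical
  rintro ⟨f, g, hg, hfg⟩
  obtain ⟨w, hw⟩ := exists_natCast_aeval_ne_zero K (Finset.prod_ne_zero_iff.2 fun x _ => hg x)
  rw [map_prod, Finset.prod_ne_zero_iff] at hw
  let F : State I → Polynomial (Polynomial ℝ) := fun x => tiltHom K blk w (f x)
  let D : State I → Polynomial (Polynomial ℝ) := fun x => tiltHom K blk w (g x)
  have hD : ∀ x, D x ≠ 0 := by
    intro x hx
    have := eval_tiltHom K h w 0 0 (g x)
    rw [show tiltHom K blk w (g x) = 0 from hx] at this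
    refine hw x (Finset.mem_univ x) ?_
    simpa [tiltedCounts] using this.symm
  let a : State I → Polynomial ℝ := fun x => (F x).coeff (D x).natDegree
  let b : State I → Polynomial ℝ := fun x => (D x).leadingCoeff
  have hb : ∀ x, b x ≠ 0 := fun x => Polynomial.leadingCoeff_ne_zero.2 (hD x)
  let x₀ : State I := blockCell blk fun _ => false
  let x₁ : State I := blockCell blk ![false, false, true, true]
  let α : Polynomial ℝ := a x₁ * b x₀
  let β : Polynomial ℝ := b x₁ * a x₀
  have key : ∀ n : ℕ, 1 ≤ n → (∏ x, b x).eval (n : ℝ) ≠ 0 → β.eval (n : ℝ) ≠ 0 ∧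
      α.eval (n : ℝ) ^ 2 = 3 * ((n : ℝ) - 1) * α.eval (n : ℝ) * β.eval (n : ℝ) +
        n * β.eval (n : ℝ) ^ 2 := by
    intro n hn hbn
    rw [Polynomial.eval_prod, Finset.prod_ne_zero_iff] at hbn
    have hbn := fun x => hbn x (Finset.mem_univ x)
    let ev := Polynomial.evalRingHom (n : ℝ)
    have hdeg : ∀ x, ((D x).map ev).natDegree = (D x).natDegree := fun x =>
      Polynomial.natDegree_map_of_leadingCoeff_ne_zero ev (hbn x)
    have hlead : ∀ x, ((D x).map ev).leadingCoeff = (b x).eval (n : ℝ) := fun x => by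
      rw [Polynomial.leadingCoeff, hdeg, Polynomial.coeff_map]; rfl
    have hDn : ∀ x, (D x).map ev ≠ 0 := fun x h0 => hbn x (by
      rw [← hlead, h0, Polynomial.leadingCoeff_zero])
    let p : ℕ → State I → ℝ := fun k x =>
      ((F x).map ev).eval (k : ℝ) / ((D x).map ev).eval (k : ℝ)
    have hp : ∀ᶠ k in atTop, IsMLE (cliqueMatrix G I) (tiltedCounts blk w n k) (p k) := by
      filter_upwards [eventually_all.2 fun x => eventually_eval_natCast_ne_zero (hDn x),
        eventually_ge_atTop 1] with k hk hk1
      refine (hfg _ (fun h0 => ?_) (fun x => ?_) (p k)).2 fun x => ?_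
      · have := congrFun h0 x₀
        simp [tiltedCounts, x₀, blockTable_blockCell h, cycleCounts] at this
        omega
      · rw [← eval_tiltHom K h]
        exact hk x
      · rw [← eval_tiltHom K h, ← eval_tiltHom K h]
    let L : State I → ℝ := fun x => (a x).eval (n : ℝ) / (b x).eval (n : ℝ)
    have hL : Tendsto p atTop (𝓝 L) := by
      refine tendsto_pi_nhds.2 fun x => ?_
      have := tendsto_eval_div_of_bounded (P := (F x).map ev) (hDn x) (hp.mono fun k hk => by
        have hs := extendedModel_subset_stdSimplex hk.1
        rw [abs_le]
        refine ⟨by linarith [hs.1 x], ?_⟩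
        rw [← hs.2]
        exact Finset.single_le_sum (fun y _ => hs.1 y) (Finset.mem_univ x))
      rw [hdeg, hlead, Polynomial.coeff_map] at this
      exact this
    -- the positive root of the quadratic equation
    have hn1 : (1 : ℝ) ≤ n := by exact_mod_cast hn
    obtain ⟨q, hq, hqn⟩ : ∃ q : ℝ, 0 < q ∧ (q ^ 2) ^ 2 = 3 * ((n : ℝ) - 1) * q ^ 2 + n := by
      set m : ℝ := 3 * ((n : ℝ) - 1) with hm
      have hm0 : 0 ≤ m := by rw [hm]; linarith
      have hdisc : 0 < m ^ 2 + 4 * n := by positivity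
      have hr : 0 < (m + √(m ^ 2 + 4 * n)) / 2 := by
        have := Real.sqrt_pos.2 hdisc
        linarith
      refine ⟨√((m + √(m ^ 2 + 4 * n)) / 2), Real.sqrt_pos.2 hr, ?_⟩
      rw [Real.sq_sqrt hr.le]
      have := Real.sq_sqrt hdisc.le
      linear_combination this / 4
    have hLeq := limit_eq_disagreement h hq hqn hp hL
    obtain ⟨hZ, -⟩ := disagreement_mem_extendedModel (I := I) h hq
    have h0 : (a x₀).eval (n : ℝ) / (b x₀).eval (n : ℝ) = (∑ β, disagreementWeight q β)⁻¹ := by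
      have := congrFun hLeq x₀
      simpa [L, x₀, blockTable_blockCell h, disagreementWeight] using this
    have h1 : (a x₁).eval (n : ℝ) / (b x₁).eval (n : ℝ) =
        (∑ β, disagreementWeight q β)⁻¹ * q ^ 2 := by
      have := congrFun hLeq x₁
      have hw1 : disagreementWeight q ![false, false, true, true] = q ^ 2 := by
        simp [disagreementWeight, Fin.prod_univ_four, sq]
      rwa [blockTable_blockCell h, hw1] at this
    have hα : α.eval (n : ℝ) = q ^ 2 * β.eval (n : ℝ) := by
      simp only [α, β, Polynomial.eval_mul]
      rw [div_eq_iff (hbn x₀)] at h0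
      rw [div_eq_iff (hbn x₁)] at h1
      rw [h0, h1]
      ring
    refine ⟨?_, ?_⟩
    · simp only [β, Polynomial.eval_mul]
      refine mul_ne_zero (hbn x₁) fun h00 => ?_
      rw [h00, zero_div] at h0
      exact (inv_pos.2 hZ).ne h0
    · rw [hα]
      linear_combination β.eval (n : ℝ) ^ 2 * hqn
  have hbprod : ∏ x, b x ≠ 0 := Finset.prod_ne_zero_iff.2 fun x _ => hb x
  have hβ : β ≠ 0 := by
    intro hβ0
    refine hbprod (eq_zero_of_eval_natCast fun n hn => ?_)
    by_contra hne
    exact (key n hn hne).1 (by rw [hβ0, Polynomial.eval_zero])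
  refine quadratic_not_rational (α := α) hβ (sub_eq_zero.1 ?_)
  refine (mul_eq_zero.1 (eq_zero_of_eval_natCast (P := (∏ x, b x) * (α ^ 2 -
    (3 * (Polynomial.X - 1) * α * β + Polynomial.X * β ^ 2))) fun n hn => ?_)).resolve_left hbprod
  rw [Polynomial.eval_mul]
  by_cases hne : (∏ x, b x).eval (n : ℝ) = 0
  · rw [hne, zero_mul]
  · have := (key n hn hne).2
    simp only [Polynomial.eval_sub, Polynomial.eval_add, Polynomial.eval_mul, Polynomial.eval_pow,
      Polynomial.eval_X, Polynomial.eval_one, Polynomial.eval_ofNat]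
    rw [this, sub_self, mul_zero]

end Irrational

end

end DiscreteModel

end

theorem theorem4p4 {V : Type u} [Fintype V] [DecidableEq V] (G : SimpleGraph V)
    (I : V → Type w) [∀ v, Fintype (I v)] [∀ v, DecidableEq (I v)] [∀ v, Nontrivial (I v)]
    (K : Subfield ℝ) :
    List.TFAE [
      DiscreteModel.IsDecomposable G,
      ∃ B ⊆ DiscreteModel.globalBinomials G I,
        ∀ P ∈ stdSimplex ℝ (DiscreteModel.State I),
          (P ∈ DiscreteModel.factoring (DiscreteModel.cliqueMatrix G I) ↔
            ∀ f ∈ B, MvPolynomial.eval P f = 0),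
      ∃ m : MonomialOrder.{max u w, max u w} (DiscreteModel.State I),
        ∃ B ⊆ DiscreteModel.globalBinomials G I,
        DiscreteModel.IsGroebnerBasis m B
          (DiscreteModel.toricIdeal (DiscreteModel.cliqueMatrix G I)),
      DiscreteModel.MLEIsRational (DiscreteModel.cliqueMatrix G I) K,
      IsClosed (DiscreteModel.imagePhi (DiscreteModel.cliqueMatrix G I))] := by
  tfae_have 1 → 2 := by
    intro h
    obtain ⟨pos, hpos⟩ := h.exists_perfectElimination
    exact ⟨_, subset_rfl, fun P hP => DiscreteModel.mem_factoring_iff_of_perfectElimination hpos hP⟩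
  tfae_have 2 → 5 := fun ⟨_, hB, h⟩ => DiscreteModel.isClosed_imagePhi_of_binomials hB h
  tfae_have 5 → 1 := by
    intro h
    by_contra hdec
    obtain ⟨blk, hblk⟩ := DiscreteModel.exists_isFourCycleMinor_of_not_isDecomposable hdec
    exact hblk.not_isClosed_imagePhi h
  tfae_have 1 → 3 := by
    intro h
    obtain ⟨pos, hpos⟩ := h.exists_perfectElimination
    obtain ⟨m, hm⟩ :=
      DiscreteModel.exists_groebnerBasis_of_perfectElimination (I := I) hpos
    exact ⟨m, _, subset_rfl, hm⟩
  tfae_have 3 → 1 := by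
    rintro ⟨m, B, hB, hspan, -⟩
    by_contra hdec
    obtain ⟨blk, hblk⟩ := DiscreteModel.exists_isFourCycleMinor_of_not_isDecomposable hdec
    exact hblk.span_ne_toricIdeal hB hspan
  tfae_have 1 → 4 := by
    intro h
    obtain ⟨pos, hpos⟩ := h.exists_perfectElimination
    exact DiscreteModel.mleIsRational_of_perfectElimination hpos K
  tfae_have 4 → 1 := by
    intro h
    by_contra hdec
    obtain ⟨blk, hblk⟩ := DiscreteModel.exists_isFourCycleMinor_of_not_isDecomposable hdec
    exact hblk.not_mleIsRational K h
  tfae_finish
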